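/- Let $(H(k))_{k\in\mathbb Z}$ and $(V(k))_{k\in\mathbb Z}$ be two families of i.i.d. positive random variables on a probability space with probability $\mathbb P$, independent of each other. Assume that there is a constant $c>0$ with $H(k)\ge c$ and $V(k)\ge c$ almost surely for all $k\in\mathbb Z$, and that there are exponents $\alpha_1,\alpha_2>0$ and constants $c_H,c_V>0$ such that, as $L\to\infty$, $$\mathbb P(H(0)>L)=c_H\,L^{-\alpha_1(1+o(1))},\qquad \mathbb P(V(0)>L)=c_V\,L^{-\alpha_2(1+o(1))}.$$ The environment $\omega$ is given by the conductances on nearest-neighbour edges of $\mathbb Z^2$ $$\omega(x,x\pm e_1)=H(x_2),\qquad \omega(x,x\pm e_2)=V(x_1),\qquad x=(x_1,x_2)\in\mathbb Z^2 .$$ For fixed $\omega$, let $X=(X_1,X_2)$ be the continuous-time random walk on $\mathbb Z^2$ started at $0$ with generator $$\mathcal L^\omega f(x)=\sum_{|e|=1}\omega(x,x+e)\,\bigl(f(x+e)-f(x)\bigr),$$ that is, the walk which waits at $x$ an exponential time of parameter $\sum_{|e|=1}\omega(x,x+e)$ and then jumps to $x+e$ with probability proportional to $\omega(x,x+e)$.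 Let $P^\omega_0$ be its (quenched) law; after a possible explosion the walk is sent to a cemetery state, at which $|X_1|=|X_2|=\infty$ by convention. Put $$\varepsilon_i=\max\Bigl(\tfrac12\bigl(\tfrac1{\alpha_i}-1\bigr),\,0\Bigr),\qquad i=1,2 .$$ Assume $\varepsilon_1\varepsilon_2<1$, and let $a_1,a_2$ be real numbers with $$a_i>\frac{1+\varepsilon_i}{1-\varepsilon_1\varepsilon_2},\qquad i=1,2 .$$ Then, for $\mathbb P$-a.e. environment $\omega$, for every $t>0$ and $i=1,2$, $$\sup_{0\le s\le t}T^{-a_i/2}\,|X_i(Ts)|\;\longrightarrow\;0\quad\text{in } P^\omega_0\text{-probability, as } T\to\infty .$$ -/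

import Mathlib

open MeasureTheory ProbabilityTheory Filter Topology
open scoped ENNReal

noncomputable section

namespace LineModel

/-- An environment on `ℤ²`: a conductance `ω x y` for each pair of sites. Only the values at
pairs of nearest neighbours matter for the walk. -/
abbrev Environment : Type := ℤ × ℤ → ℤ × ℤ → ℝ

/-- The line environment: horizontal edges at height `x₂` have conductance `h x₂`, vertical
edges at abscissa `x₁` have conductance `v x₁`; all other pairs have conductance `0`. -/
def lineEnvironment (h v : ℤ → ℝ) : Environment := fun x y =>
  if x.2 = y.2 ∧ |x.1 - y.1| = 1 then h x.2
  else if x.1 = y.1 ∧ |x.2 - y.2| = 1 then v x.1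
  else 0

/-- The four nearest neighbours of `x` in `ℤ²`. -/
def neighbors (x : ℤ × ℤ) : Finset (ℤ × ℤ) :=
  {(x.1 + 1, x.2), (x.1 - 1, x.2), (x.1, x.2 + 1), (x.1, x.2 - 1)}

/-- The total rate at which the walk with generator
`(L f)(x) = ∑_{|e| = 1} ω(x, x + e) (f (x + e) - f x)` leaves `x`. -/
def totalRate (ω : Environment) (x : ℤ × ℤ) : ℝ≥0∞ :=
  ∑ y ∈ neighbors x, ENNReal.ofReal (ω x y)

/-- The law of the next site visited after `x`: each neighbour `y` has probability
`ω(x, y) / totalRate ω x` (and `x` is absorbing if its total rate is zero). -/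
def jumpMeasure (ω : Environment) (x : ℤ × ℤ) : Measure (ℤ × ℤ) :=
  open Classical in
  if totalRate ω x = 0 then Measure.dirac x
  else (totalRate ω x)⁻¹ • ∑ y ∈ neighbors x, ENNReal.ofReal (ω x y) • Measure.dirac y

lemma totalRate_ne_top (ω : Environment) (x : ℤ × ℤ) : totalRate ω x ≠ ∞ := by
  unfold totalRate
  exact ENNReal.sum_ne_top.2 fun _ _ => ENNReal.ofReal_ne_top

lemma jumpMeasure_univ (ω : Environment) (x : ℤ × ℤ) : jumpMeasure ω x Set.univ = 1 := by
  unfold jumpMeasure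
  split_ifs with h
  · simp
  · simp only [Measure.smul_apply, Measure.finsetSum_apply, measure_univ, smul_eq_mul, mul_one]
    exact ENNReal.inv_mul_cancel h (totalRate_ne_top ω x)

/-- The transition kernel of the jump chain. -/
def jumpKernel (ω : Environment) : Kernel (ℤ × ℤ) (ℤ × ℤ) where
  toFun := jumpMeasure ω
  measurable' := measurable_of_countable _

instance (ω : Environment) : IsMarkovKernel (jumpKernel ω) :=
  ⟨fun x => ⟨jumpMeasure_univ ω x⟩⟩

/-- The step of the jump chain as a kernel depending on the whole past, through its last site. -/
def stepKernel (ω : Environment) (n : ℕ) : Kernel (Finset.Iic n → ℤ × ℤ) (ℤ × ℤ) :=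
  (jumpKernel ω).comap (fun past => past ⟨n, Finset.mem_Iic.2 le_rfl⟩) (measurable_pi_apply _)

instance (ω : Environment) (n : ℕ) : IsMarkovKernel (stepKernel ω n) := by
  unfold stepKernel; infer_instance

/-- The law of the jump chain started at the origin. -/
def jumpChainLaw (ω : Environment) : Measure (ℕ → ℤ × ℤ) :=
  Kernel.traj (X := fun _ => ℤ × ℤ) (stepKernel ω) 0 (fun _ => (0, 0))

/-- The space on which the walk is built: a sequence of visited sites and a sequence of
(unit rate) exponential clocks. -/
abbrev PathSpace : Type := (ℕ → ℤ × ℤ) × (ℕ → ℝ)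

/-- The quenched law `P₀^ω`: the sites form the jump chain started at the origin and the clocks
are i.i.d. exponential variables of mean one, independent of the jump chain. -/
def quenchedLaw (ω : Environment) : Measure PathSpace :=
  (jumpChainLaw ω).prod (Measure.infinitePi fun _ : ℕ => expMeasure 1)

instance (ω : Environment) : IsProbabilityMeasure (jumpChainLaw ω) := by
  unfold jumpChainLaw; infer_instance

instance (ω : Environment) : IsProbabilityMeasure (quenchedLaw ω) := by
  have : IsProbabilityMeasure (expMeasure 1) := isProbabilityMeasure_expMeasure one_pos
  unfold quenchedLaw; infer_instance

/-- The time that the walk spends at the `n`-th visited site: an exponential variable of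
parameter `totalRate ω (p.1 n)`, given the sites. -/
def holdingTime (ω : Environment) (p : PathSpace) (n : ℕ) : ℝ≥0∞ :=
  ENNReal.ofReal (p.2 n) / totalRate ω (p.1 n)

/-- The time of the `n`-th jump (`0` for `n = 0`). -/
def jumpTime (ω : Environment) (p : PathSpace) (n : ℕ) : ℝ≥0∞ :=
  ∑ k ∈ Finset.range n, holdingTime ω p k

/-- The variable speed random walk at time `t`: its position is the `n`-th visited site when
`t` lies between the `n`-th jump time (included) and the next one (excluded). If infinitely many
jumps have occurred up to time `t` (explosion), the walk is in the cemetery state `none`. -/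
def walk (ω : Environment) (p : PathSpace) (t : ℝ) : Option (ℤ × ℤ) :=
  open Classical in
  if h : ∃ n : ℕ, ENNReal.ofReal t < jumpTime ω p (n + 1) then some (p.1 (Nat.find h)) else none

/-- `|x₁|`, with the value `∞` in the cemetery state. -/
def absFst : Option (ℤ × ℤ) → ℝ≥0∞
  | some x => (x.1.natAbs : ℝ≥0∞)
  | none => ∞

/-- `|x₂|`, with the value `∞` in the cemetery state. -/
def absSnd : Option (ℤ × ℤ) → ℝ≥0∞
  | some x => (x.2.natAbs : ℝ≥0∞)
  | none => ∞

/-- `sup_{0 ≤ s ≤ t} T^{-a/2} |X₁(T s)|`. -/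
def supFst (ω : Environment) (a t T : ℝ) (p : PathSpace) : ℝ≥0∞ :=
  ⨆ s ∈ Set.Icc (0 : ℝ) t, ENNReal.ofReal (T ^ (-a / 2)) * absFst (walk ω p (T * s))

/-- `sup_{0 ≤ s ≤ t} T^{-a/2} |X₂(T s)|`. -/
def supSnd (ω : Environment) (a t T : ℝ) (p : PathSpace) : ℝ≥0∞ :=
  ⨆ s ∈ Set.Icc (0 : ℝ) t, ENNReal.ofReal (T ^ (-a / 2)) * absSnd (walk ω p (T * s))

/-- Convergence to `0` in `μ`-probability, as `T → ∞`, of a family of `[0, ∞]`-valued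
functions. -/
def TendstoZeroInProbability {E : Type*} [MeasurableSpace E] (μ : Measure E)
    (Z : ℝ → E → ℝ≥0∞) : Prop :=
  ∀ δ : ℝ, 0 < δ → Tendsto (fun T : ℝ => μ {p | ENNReal.ofReal δ ≤ Z T p}) atTop (𝓝 0)

/-- The tail condition `P(Y > L) = c L^{-α (1 + o(1))}` as `L → ∞`, for some constant `c > 0`. -/
def HasTailExponent {Ω : Type*} [MeasurableSpace Ω] (P : Measure Ω) (Y : Ω → ℝ) (α : ℝ) : Prop :=
  ∃ c : ℝ, 0 < c ∧ ∃ r : ℝ → ℝ, Tendsto r atTop (𝓝 0) ∧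
    ∀ᶠ L : ℝ in atTop, P.real {e | L < Y e} = c * L ^ (-α * (1 + r L))

/-- The exponent `ε = max ((1/α - 1)/2, 0)` associated with a tail exponent `α`. -/
def epsilonExponent (α : ℝ) : ℝ := max ((1 / α - 1) / 2) 0

end LineModel

end

/-!
The displacement of the walk is controlled by an averaged energy estimate, which is then transferred
to the origin by stationarity of the environment; no heat kernel bound is needed.

Fix the killing rate `ρ = 1 / T` and let `g x` be the Laplace transform at `ρ` of the time at which
the walk started at `x` leaves a box `[-2N₁, 2N₁] × [-2N₂, 2N₂]` or explodes (`exitLimit`). It is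
the decreasing limit of functions given by a recursion (`exitTransform`), so it satisfies `0 ≤ g ≤ 1`
and the resolvent equation `L g = ρ g` in the box. Testing this equation against `η² g`, where `η`
is a product of two tent functions, gives the Caccioppoli inequality
`ρ ∑ η² g² ≤ ∑ ω (∇η)²` (`sum_box_sq_exitLimit_le`). The right-hand side involves only the sums of
`H` and of `V` over the lines which meet the box, and the average of `g²` over the starting points
in the inner box `[-N₁, N₁] × [-N₂, N₂]` is at most a constant times
`T (∑ H / (N₁² N₂) + ∑ V / (N₁ N₂²))`.

The environment is invariant in law under the translations of `ℤ²`. Hence the expectation of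
`g(0)²` for a slightly larger box is at most the expectation of this average, truncated at `1`
(`lintegral_sq_exitLimit_le`). Fractional moments suffice to bound it: `E[H(0)^β] < ∞` for
`β < α₁`, and `(∑ H)^β ≤ ∑ H^β` for `β ≤ 1`. With `Nᵢ = T^(bᵢ / 2)` the outcome is a negative power
of `T` as soon as `b₁ > 1 + ε₁ b₂` and `b₂ > 1 + ε₂ b₁`, and such `bᵢ` exist below `aᵢ` because
`(1 + εᵢ) / (1 - ε₁ ε₂)` is the fixed point of this system. Along `T = 2 ^ k` the bounds are
summable, so `g(0) → 0` almost surely, and the exponential Markov inequality (`quenchedLaw_exit_le`)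
turns this into a bound on the quenched probability of leaving the box, or of exploding,
before time `T`.
-/

namespace LineModel

/-! ### The exit time and its Laplace transform -/

lemma lintegral_exp_neg_mul_expMeasure {s : ℝ} (hs : 0 ≤ s) :
    ∫⁻ x, ENNReal.ofReal (Real.exp (-(s * max x 0))) ∂expMeasure 1
      = ENNReal.ofReal (1 / (1 + s)) := by
  have hm : Measurable (exponentialPDF 1) :=
    (measurable_exponentialPDFReal 1).ennreal_ofReal
  have h : expMeasure 1 = volume.withDensity (exponentialPDF 1) := rfl
  rw [h, lintegral_withDensity_eq_lintegral_mul _ hm (by fun_prop)]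
  have key : ∀ x, (exponentialPDF 1 * fun x => ENNReal.ofReal (Real.exp (-(s * max x 0)))) x
      = ENNReal.ofReal (1 / (1 + s)) * exponentialPDF (1 + s) x := by
    intro x
    rw [Pi.mul_apply]
    rcases lt_or_ge x 0 with hx | hx
    · simp [exponentialPDF_of_neg hx]
    · rw [exponentialPDF_of_nonneg hx, exponentialPDF_of_nonneg hx, max_eq_left hx,
        ← ENNReal.ofReal_mul (by positivity), ← ENNReal.ofReal_mul (by positivity)]
      congr 1
      rw [one_mul, one_mul, ← Real.exp_add, ← mul_assoc, one_div,
        inv_mul_cancel₀ (by positivity), one_mul]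
      congr 1; ring
  simp_rw [key]
  have hm' : Measurable (exponentialPDF (1 + s)) :=
    (measurable_exponentialPDFReal (1 + s)).ennreal_ofReal
  rw [lintegral_const_mul _ hm',
    lintegral_exponentialPDF_eq_one (by positivity), mul_one]

/-- The Markov property of the jump chain at a deterministic time. -/
lemma lintegral_jumpChainLaw_succ (ω : Environment) (n : ℕ)
    (g : (Finset.Iic n → ℤ × ℤ) → ℝ≥0∞) (hg : Measurable g) (f : ℤ × ℤ → ℝ≥0∞) :
    ∫⁻ x, g (Preorder.frestrictLe n x) * f (x (n + 1)) ∂jumpChainLaw ω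
      = ∫⁻ x, g (Preorder.frestrictLe n x) * ∫⁻ y, f y ∂jumpKernel ω (x n) ∂jumpChainLaw ω := by
  have hf : Measurable f := measurable_of_countable f
  set κ := stepKernel ω
  have hd : jumpChainLaw ω = (Kernel.traj κ n ∘ₖ Kernel.partialTraj κ 0 n) fun _ => (0, 0) := by
    rw [Kernel.traj_comp_partialTraj (Nat.zero_le n)]; rfl
  -- restarted from its past `z` up to time `n`, the chain keeps this past almost surely
  have hae : ∀ z : Finset.Iic n → ℤ × ℤ, ∀ᵐ x ∂Kernel.traj (X := fun _ => ℤ × ℤ) κ n z,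
      Preorder.frestrictLe n x = z := by
    intro z
    have h1 := Kernel.traj_map_frestrictLe_of_le (X := fun _ => ℤ × ℤ) (κ := κ) (le_refl n)
    have h2 : (Kernel.traj (X := fun _ => ℤ × ℤ) κ n z).map (Preorder.frestrictLe n)
        = Measure.dirac z := by
      rw [← Kernel.map_apply _ (Preorder.measurable_frestrictLe n), h1, Kernel.deterministic_apply]
      rfl
    have h3 : ∀ᵐ y ∂((Kernel.traj (X := fun _ => ℤ × ℤ) κ n z).map (Preorder.frestrictLe n)),
        y = z := by
      rw [h2, ae_dirac_eq]
      exact eventually_pure.2 rfl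
    exact ae_of_ae_map (Preorder.measurable_frestrictLe n).aemeasurable h3
  have hstep : ∀ z : Finset.Iic n → ℤ × ℤ,
      ∫⁻ x, f (x (n + 1)) ∂Kernel.traj (X := fun _ => ℤ × ℤ) κ n z
        = ∫⁻ y, f y ∂jumpKernel ω (z ⟨n, Finset.mem_Iic.2 le_rfl⟩) := by
    intro z
    have h1 := Kernel.map_traj_succ_self (X := fun _ => ℤ × ℤ) (κ := κ) (a := n)
    have h2 : (Kernel.traj (X := fun _ => ℤ × ℤ) κ n z).map (fun x => x (n + 1)) = κ n z := by
      rw [← Kernel.map_apply _ (measurable_pi_apply _), h1]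
    rw [← lintegral_map hf (measurable_pi_apply _), h2]
    simp only [κ, stepKernel, Kernel.comap_apply]
  have hk : Measurable fun x : ℤ × ℤ => ∫⁻ y, f y ∂jumpKernel ω x := measurable_of_countable _
  have hgm : Measurable fun x : ℕ → ℤ × ℤ => g (Preorder.frestrictLe n x) :=
    hg.comp (Preorder.measurable_frestrictLe n)
  have hm1 : Measurable fun x : ℕ → ℤ × ℤ => g (Preorder.frestrictLe n x) * f (x (n + 1)) :=
    hgm.mul (hf.comp (measurable_pi_apply _))
  have hm2 : Measurable fun x : ℕ → ℤ × ℤ =>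
      g (Preorder.frestrictLe n x) * ∫⁻ y, f y ∂jumpKernel ω (x n) :=
    hgm.mul (hk.comp (measurable_pi_apply _))
  rw [hd, Kernel.lintegral_comp _ _ _ hm1, Kernel.lintegral_comp _ _ _ hm2]
  refine lintegral_congr fun z => ?_
  have e1 : ∫⁻ x, g (Preorder.frestrictLe n x) * f (x (n + 1))
      ∂Kernel.traj (X := fun _ => ℤ × ℤ) κ n z
      = ∫⁻ x, g z * f (x (n + 1)) ∂Kernel.traj (X := fun _ => ℤ × ℤ) κ n z :=
    lintegral_congr_ae ((hae z).mono fun x hx => by simp only [hx])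
  have e2 : ∫⁻ x, g (Preorder.frestrictLe n x) * ∫⁻ y, f y ∂jumpKernel ω (x n)
      ∂Kernel.traj (X := fun _ => ℤ × ℤ) κ n z
      = ∫⁻ _, g z * ∫⁻ y, f y ∂jumpKernel ω (z ⟨n, Finset.mem_Iic.2 le_rfl⟩)
          ∂Kernel.traj (X := fun _ => ℤ × ℤ) κ n z :=
    lintegral_congr_ae ((hae z).mono fun x hx => by
      have : x n = z ⟨n, Finset.mem_Iic.2 le_rfl⟩ := by rw [← hx]; rfl
      simp only [hx, this])
  have hm3 : Measurable fun x : ℕ → ℤ × ℤ => f (x (n + 1)) := hf.comp (measurable_pi_apply _)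
  rw [e1, e2, lintegral_const_mul _ hm3, hstep]
  simp

open Classical in
/-- One step of the jump chain, killed outside `Q` and at rate `ρ` inside `Q`: the factor
`r / (r + ρ)` is the Laplace transform at `ρ` of an exponential holding time of rate `r`. -/
noncomputable def killedStep (ω : Environment) (ρ : ℝ) (Q : Set (ℤ × ℤ)) (f : ℤ × ℤ → ℝ≥0∞)
    (x : ℤ × ℤ) : ℝ≥0∞ :=
  if x ∈ Q then
    ENNReal.ofReal ((totalRate ω x).toReal / ((totalRate ω x).toReal + ρ)) *
      ∫⁻ y, f y ∂jumpKernel ω x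
  else 0

open Classical in
/-- The discount `exp (-ρ J)`, where `J` is the time of the `m`-th jump, if the first `m` visited
sites belong to `Q`, and `0` otherwise. The clock appears as `max (p.2 j) 0` because `holdingTime`
truncates negative values. -/
noncomputable def discount (ω : Environment) (ρ : ℝ) (Q : Set (ℤ × ℤ)) (m : ℕ) (p : PathSpace) :
    ℝ≥0∞ :=
  ∏ j ∈ Finset.range m, if p.1 j ∈ Q then
    ENNReal.ofReal (Real.exp (-(ρ / (totalRate ω (p.1 j)).toReal * max (p.2 j) 0))) else 0

open Classical in
lemma measurable_discount_factor (ω : Environment) (ρ : ℝ) (Q : Set (ℤ × ℤ)) :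
    Measurable fun q : (ℤ × ℤ) × ℝ => if q.1 ∈ Q then
      ENNReal.ofReal (Real.exp (-(ρ / (totalRate ω q.1).toReal * max q.2 0))) else 0 := by
  refine measurable_from_prod_countable_right fun x => ?_
  by_cases hx : x ∈ Q
  · simp only [hx, if_true]; fun_prop
  · simp only [hx, if_false]; fun_prop

lemma measurable_discount (ω : Environment) (ρ : ℝ) (Q : Set (ℤ × ℤ)) (m : ℕ) :
    Measurable (discount ω ρ Q m) :=
  Finset.measurable_fun_prod _ fun j _ => (measurable_discount_factor ω ρ Q).comp
    (f := fun p : PathSpace => (p.1 j, p.2 j)) (((measurable_pi_apply j).comp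
      measurable_fst).prodMk ((measurable_pi_apply j).comp measurable_snd))

open Classical in
/-- The joint law of the first `m` sites and holding times, tested against the discount: the clocks
are integrated out first, and the jump chain then contributes one power of `killedStep` per step. -/
lemma lintegral_discount_mul (ω : Environment) {ρ : ℝ} (hρ : 0 < ρ)
    (hω : ∀ x, 0 < (totalRate ω x).toReal) (Q : Set (ℤ × ℤ)) (m : ℕ) (f : ℤ × ℤ → ℝ≥0∞) :
    ∫⁻ p, discount ω ρ Q m p * f (p.1 m) ∂quenchedLaw ω = (killedStep ω ρ Q)^[m] f (0, 0) := by
  have : IsProbabilityMeasure (expMeasure 1) := isProbabilityMeasure_expMeasure one_pos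
  have hf : Measurable f := measurable_of_countable f
  set L : ℤ × ℤ → ℝ≥0∞ := fun x => if x ∈ Q then
    ENNReal.ofReal ((totalRate ω x).toReal / ((totalRate ω x).toReal + ρ)) else 0 with hL
  have hLm : Measurable L := measurable_of_countable L
  have hfac := measurable_discount_factor ω ρ Q
  have hdm := measurable_discount ω ρ Q m
  have hclock : ∀ x : ℕ → ℤ × ℤ,
      ∫⁻ y, discount ω ρ Q m (x, y) ∂Measure.infinitePi (fun _ : ℕ => expMeasure 1)
        = ∏ j ∈ Finset.range m, L (x j) := by
    intro x
    set φ : ℕ → ℝ → ℝ≥0∞ := fun j e => if x j ∈ Q then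
      ENNReal.ofReal (Real.exp (-(ρ / (totalRate ω (x j)).toReal * max e 0))) else 0 with hφ
    have hφm : ∀ j, Measurable (φ j) := fun j => by
      have := hfac.comp (measurable_prodMk_left (x := x j))
      exact this
    have hind : iIndepFun (fun j (y : ℕ → ℝ) => φ j (y j))
        (Measure.infinitePi (fun _ : ℕ => expMeasure 1)) := iIndepFun_infinitePi hφm
    have h1 : ∀ y, discount ω ρ Q m (x, y) = ∏ j ∈ Finset.range m, φ j (y j) := fun y => rfl
    simp_rw [h1]
    rw [lintegral_prod_eq_prod_lintegral_of_indepFun _ _ hind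
      (fun j => (hφm j).comp (measurable_pi_apply j))]
    refine Finset.prod_congr rfl fun j _ => ?_
    have h2 : ∫⁻ y, φ j (y j) ∂Measure.infinitePi (fun _ : ℕ => expMeasure 1)
        = ∫⁻ e, φ j e ∂expMeasure 1 := by
      have h3 := lintegral_map (μ := Measure.infinitePi (fun _ : ℕ => expMeasure 1)) (hφm j)
        (measurable_pi_apply (X := fun _ => ℝ) j)
      rw [← h3, Measure.infinitePi_map_eval (fun _ : ℕ => expMeasure 1) j]
    rw [h2]
    by_cases hx : x j ∈ Q
    · simp only [hφ, hL, hx, if_true]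
      rw [lintegral_exp_neg_mul_expMeasure (div_nonneg hρ.le (hω _).le)]
      congr 1
      have := hω (x j)
      field_simp
    · simp only [hφ, hL, hx, if_false, lintegral_zero]
  have hred : ∫⁻ p, discount ω ρ Q m p * f (p.1 m) ∂quenchedLaw ω
      = ∫⁻ x, (∏ j ∈ Finset.range m, L (x j)) * f (x m) ∂jumpChainLaw ω := by
    unfold quenchedLaw
    have hm1 : Measurable fun p : PathSpace => discount ω ρ Q m p * f (p.1 m) :=
      hdm.mul (hf.comp ((measurable_pi_apply m).comp measurable_fst))
    rw [lintegral_prod _ hm1.aemeasurable]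
    refine lintegral_congr fun x => ?_
    simp only
    have hm2 : Measurable fun y => discount ω ρ Q m (x, y) := hdm.comp measurable_prodMk_left
    rw [lintegral_mul_const _ hm2, hclock]
  rw [hred]
  clear hred hclock hdm hfac hf
  induction m generalizing f with
  | zero =>
    simp only [Finset.range_zero, Finset.prod_empty, one_mul, Function.iterate_zero, id_eq]
    have h0 : (jumpChainLaw ω).map (Preorder.frestrictLe 0)
        = Measure.dirac (fun _ => ((0 : ℤ), (0 : ℤ))) := by
      unfold jumpChainLaw
      rw [Kernel.traj_map_frestrictLe_apply, Kernel.partialTraj_self, Kernel.id_apply]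
    have h1 : ∫⁻ x, f (x 0) ∂jumpChainLaw ω
        = ∫⁻ z, f (z ⟨0, Finset.mem_Iic.2 le_rfl⟩)
          ∂((jumpChainLaw ω).map (Preorder.frestrictLe (π := fun _ => ℤ × ℤ) 0)) := by
      have hm1 : Measurable fun z : Finset.Iic 0 → ℤ × ℤ =>
          f (z ⟨0, Finset.mem_Iic.2 le_rfl⟩) :=
        (measurable_of_countable f).comp (measurable_pi_apply _)
      rw [lintegral_map hm1 (Preorder.measurable_frestrictLe 0)]
      rfl
    rw [h1, h0, lintegral_dirac]
  | succ m ih =>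
    have hg : Measurable fun z : Finset.Iic m → ℤ × ℤ =>
        ∏ j ∈ (Finset.range (m + 1)).attach,
          L (z ⟨j.1, Finset.mem_Iic.2 (Nat.lt_succ_iff.1 (Finset.mem_range.1 j.2))⟩) :=
      Finset.measurable_fun_prod _ fun j _ => hLm.comp (measurable_pi_apply _)
    have h1 := lintegral_jumpChainLaw_succ ω m _ hg f
    have h2 : ∀ x : ℕ → ℤ × ℤ, (∏ j ∈ (Finset.range (m + 1)).attach,
          L (Preorder.frestrictLe (π := fun _ => ℤ × ℤ) m x
            ⟨j.1, Finset.mem_Iic.2 (Nat.lt_succ_iff.1 (Finset.mem_range.1 j.2))⟩))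
        = ∏ j ∈ Finset.range (m + 1), L (x j) := fun x =>
      Finset.prod_attach (Finset.range (m + 1)) fun j => L (x j)
    simp only [h2] at h1
    rw [h1, Function.iterate_succ_apply, ← ih]
    refine lintegral_congr fun x => ?_
    rw [Finset.prod_range_succ, mul_assoc]
    congr 1
    simp only [hL, killedStep]
    split_ifs <;> simp

lemma killedStep_add (ω : Environment) (ρ : ℝ) (Q : Set (ℤ × ℤ)) (f g : ℤ × ℤ → ℝ≥0∞) :
    killedStep ω ρ Q (f + g) = killedStep ω ρ Q f + killedStep ω ρ Q g := by
  ext x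
  simp only [killedStep, Pi.add_apply]
  split_ifs
  · rw [lintegral_add_left (measurable_of_countable f), mul_add]
  · simp

lemma killedStep_sum (ω : Environment) (ρ : ℝ) (Q : Set (ℤ × ℤ)) (n : ℕ)
    (f : ℕ → ℤ × ℤ → ℝ≥0∞) :
    killedStep ω ρ Q (∑ m ∈ Finset.range n, f m)
      = ∑ m ∈ Finset.range n, killedStep ω ρ Q (f m) := by
  induction n with
  | zero => ext x; simp [killedStep]
  | succ n ih => rw [Finset.sum_range_succ, killedStep_add, ih, Finset.sum_range_succ]

lemma lintegral_jumpKernel (ω : Environment) (x : ℤ × ℤ) (hx : totalRate ω x ≠ 0)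
    (f : ℤ × ℤ → ℝ≥0∞) :
    ∫⁻ y, f y ∂jumpKernel ω x
      = (totalRate ω x)⁻¹ * ∑ y ∈ neighbors x, ENNReal.ofReal (ω x y) * f y := by
  have h : jumpKernel ω x
      = (totalRate ω x)⁻¹ • ∑ y ∈ neighbors x, ENNReal.ofReal (ω x y) • Measure.dirac y := by
    change jumpMeasure ω x = _
    rw [jumpMeasure, if_neg hx]
  rw [h, lintegral_smul_measure, lintegral_finsetSum_measure]
  simp [lintegral_smul_measure]

lemma sum_neighbors_lineEnvironment {M : Type*} [AddCommMonoid M] (h v : ℤ → ℝ) (x : ℤ × ℤ)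
    (F : ℝ → ℤ × ℤ → M) :
    ∑ y ∈ neighbors x, F (lineEnvironment h v x y) y
      = F (h x.2) (x.1 + 1, x.2) + (F (h x.2) (x.1 - 1, x.2)
        + (F (v x.1) (x.1, x.2 + 1) + F (v x.1) (x.1, x.2 - 1))) := by
  unfold neighbors
  rw [Finset.sum_insert, Finset.sum_insert, Finset.sum_insert, Finset.sum_singleton]
  · simp [lineEnvironment]
  · simp only [Finset.mem_singleton, Prod.mk.injEq]; omega
  · simp only [Finset.mem_insert, Finset.mem_singleton, Prod.mk.injEq]; omega
  · simp only [Finset.mem_insert, Finset.mem_singleton, Prod.mk.injEq]; omega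

lemma totalRate_lineEnvironment {h v : ℤ → ℝ} (hh : ∀ k, 0 < h k) (hv : ∀ k, 0 < v k)
    (x : ℤ × ℤ) :
    totalRate (lineEnvironment h v) x = ENNReal.ofReal (2 * h x.2 + 2 * v x.1) := by
  have h1 := hh x.2
  have h2 := hv x.1
  unfold totalRate
  rw [sum_neighbors_lineEnvironment h v x fun c _ => ENNReal.ofReal c,
    ← ENNReal.ofReal_add h2.le h2.le, ← ENNReal.ofReal_add h1.le (by positivity),
    ← ENNReal.ofReal_add h1.le (by positivity)]
  congr 1; ring

lemma toReal_totalRate_lineEnvironment {h v : ℤ → ℝ} (hh : ∀ k, 0 < h k) (hv : ∀ k, 0 < v k)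
    (x : ℤ × ℤ) :
    (totalRate (lineEnvironment h v) x).toReal = 2 * h x.2 + 2 * v x.1 := by
  rw [totalRate_lineEnvironment hh hv,
    ENNReal.toReal_ofReal (by linarith [hh x.2, hv x.1])]

open Classical in
/-- The function `x ↦ E_x[exp (-ρ J)]`, where `J` is the time at which the walk in the line
environment leaves `Q` or makes its `n`-th jump, whichever comes first; it is given here by its
recursion in `n`. -/
noncomputable def exitTransform (h v : ℤ → ℝ) (ρ : ℝ) (Q : Set (ℤ × ℤ)) : ℕ → ℤ × ℤ → ℝ
  | 0, _ => 1
  | n + 1, x => if x ∈ Q then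
      (h x.2 * (exitTransform h v ρ Q n (x.1 + 1, x.2) + exitTransform h v ρ Q n (x.1 - 1, x.2))
        + v x.1 * (exitTransform h v ρ Q n (x.1, x.2 + 1)
          + exitTransform h v ρ Q n (x.1, x.2 - 1))) / (2 * h x.2 + 2 * v x.1 + ρ)
    else 1

lemma exitTransform_succ_of_mem (h v : ℤ → ℝ) (ρ : ℝ) {Q : Set (ℤ × ℤ)} (n : ℕ) {x : ℤ × ℤ}
    (hx : x ∈ Q) :
    exitTransform h v ρ Q (n + 1) x
      = (h x.2 * (exitTransform h v ρ Q n (x.1 + 1, x.2) + exitTransform h v ρ Q n (x.1 - 1, x.2))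
        + v x.1 * (exitTransform h v ρ Q n (x.1, x.2 + 1)
          + exitTransform h v ρ Q n (x.1, x.2 - 1))) / (2 * h x.2 + 2 * v x.1 + ρ) := by
  rw [exitTransform, if_pos hx]

lemma exitTransform_succ_of_notMem (h v : ℤ → ℝ) (ρ : ℝ) {Q : Set (ℤ × ℤ)} (n : ℕ) {x : ℤ × ℤ}
    (hx : x ∉ Q) : exitTransform h v ρ Q (n + 1) x = 1 := by
  rw [exitTransform, if_neg hx]

lemma exitTransform_nonneg {h v : ℤ → ℝ} (hh : ∀ k, 0 < h k) (hv : ∀ k, 0 < v k) {ρ : ℝ}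
    (hρ : 0 < ρ) (Q : Set (ℤ × ℤ)) (n : ℕ) (x : ℤ × ℤ) : 0 ≤ exitTransform h v ρ Q n x := by
  induction n generalizing x with
  | zero => simp [exitTransform]
  | succ n ih =>
    rw [exitTransform]
    split_ifs
    · have h1 := hh x.2
      have h2 := hv x.1
      have i1 := ih (x.1 + 1, x.2)
      have i2 := ih (x.1 - 1, x.2)
      have i3 := ih (x.1, x.2 + 1)
      have i4 := ih (x.1, x.2 - 1)
      positivity
    · exact zero_le_one

lemma killedStep_ofReal {h v : ℤ → ℝ} (hh : ∀ k, 0 < h k) (hv : ∀ k, 0 < v k) {ρ : ℝ}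
    (hρ : 0 < ρ) {Q : Set (ℤ × ℤ)} {f : ℤ × ℤ → ℝ} (hf : ∀ x, 0 ≤ f x) {x : ℤ × ℤ} (hx : x ∈ Q) :
    killedStep (lineEnvironment h v) ρ Q (fun y => ENNReal.ofReal (f y)) x
      = ENNReal.ofReal ((h x.2 * (f (x.1 + 1, x.2) + f (x.1 - 1, x.2))
        + v x.1 * (f (x.1, x.2 + 1) + f (x.1, x.2 - 1))) / (2 * h x.2 + 2 * v x.1 + ρ)) := by
  have h1 := hh x.2
  have h2 := hv x.1
  have hr : 0 < 2 * h x.2 + 2 * v x.1 := by positivity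
  have f1 := hf (x.1 + 1, x.2)
  have f2 := hf (x.1 - 1, x.2)
  have f3 := hf (x.1, x.2 + 1)
  have f4 := hf (x.1, x.2 - 1)
  have hne : totalRate (lineEnvironment h v) x ≠ 0 := by
    rw [totalRate_lineEnvironment hh hv]
    exact (ENNReal.ofReal_pos.2 hr).ne'
  rw [killedStep, if_pos hx, toReal_totalRate_lineEnvironment hh hv, lintegral_jumpKernel _ _ hne,
    totalRate_lineEnvironment hh hv,
    sum_neighbors_lineEnvironment h v x fun c y => ENNReal.ofReal c * ENNReal.ofReal (f y),
    ← ENNReal.ofReal_inv_of_pos hr, ← ENNReal.ofReal_mul h1.le, ← ENNReal.ofReal_mul h1.le,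
    ← ENNReal.ofReal_mul h2.le, ← ENNReal.ofReal_mul h2.le,
    ← ENNReal.ofReal_add (by positivity) (by positivity),
    ← ENNReal.ofReal_add (by positivity) (by positivity),
    ← ENNReal.ofReal_add (by positivity) (by positivity),
    ← ENNReal.ofReal_mul (by positivity), ← ENNReal.ofReal_mul (by positivity)]
  congr 1
  field_simp
  ring

open Classical in
/-- The decomposition of `exitTransform` according to the number `m < n` of jumps made when the
walk leaves `Q`. -/
lemma ofReal_exitTransform {h v : ℤ → ℝ} (hh : ∀ k, 0 < h k) (hv : ∀ k, 0 < v k) {ρ : ℝ}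
    (hρ : 0 < ρ) (Q : Set (ℤ × ℤ)) (n : ℕ) :
    (fun x => ENNReal.ofReal (exitTransform h v ρ Q n x))
      = ∑ m ∈ Finset.range n, (killedStep (lineEnvironment h v) ρ Q)^[m] (Qᶜ.indicator 1)
        + (killedStep (lineEnvironment h v) ρ Q)^[n] 1 := by
  induction n with
  | zero => ext x; simp [exitTransform]
  | succ n ih =>
    have hstep : (fun x => ENNReal.ofReal (exitTransform h v ρ Q (n + 1) x))
        = Qᶜ.indicator 1 + killedStep (lineEnvironment h v) ρ Q
          (fun x => ENNReal.ofReal (exitTransform h v ρ Q n x)) := by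
      ext x
      by_cases hx : x ∈ Q
      · rw [Pi.add_apply, killedStep_ofReal hh hv hρ (exitTransform_nonneg hh hv hρ Q n) hx]
        simp [exitTransform, hx]
      · simp [exitTransform, hx, killedStep]
    rw [hstep, ih, killedStep_add, killedStep_sum, Finset.sum_range_succ',
      Function.iterate_succ_apply', Function.iterate_zero, id_eq]
    simp_rw [Function.iterate_succ_apply']
    abel

lemma jumpTime_mono (ω : Environment) (p : PathSpace) : Monotone (jumpTime ω p) :=
  fun _ _ hmn => Finset.sum_le_sum_of_subset (Finset.range_mono hmn)

lemma ofReal_exp_le_discount {ω : Environment} (hω : ∀ x, 0 < (totalRate ω x).toReal) {ρ : ℝ}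
    (hρ : 0 < ρ) {Q : Set (ℤ × ℤ)} {m : ℕ} {p : PathSpace} (hQ : ∀ j < m, p.1 j ∈ Q) {t : ℝ}
    (ht : 0 ≤ t) (hJ : jumpTime ω p m ≤ ENNReal.ofReal t) :
    ENNReal.ofReal (Real.exp (-(ρ * t))) ≤ discount ω ρ Q m p := by
  have hterm : ∀ j, 0 ≤ max (p.2 j) 0 / (totalRate ω (p.1 j)).toReal := fun j =>
    div_nonneg (le_max_right _ _) (hω _).le
  have hJ' : jumpTime ω p m
      = ENNReal.ofReal (∑ j ∈ Finset.range m, max (p.2 j) 0 / (totalRate ω (p.1 j)).toReal) := by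
    rw [ENNReal.ofReal_sum_of_nonneg fun j _ => hterm j]
    refine Finset.sum_congr rfl fun j _ => ?_
    rw [holdingTime, ENNReal.ofReal_div_of_pos (hω _), ENNReal.ofReal_max,
      ENNReal.ofReal_toReal (totalRate_ne_top ω _)]
    simp
  rw [hJ', ENNReal.ofReal_le_ofReal_iff ht] at hJ
  have hD : discount ω ρ Q m p = ENNReal.ofReal
      (Real.exp (-(ρ * ∑ j ∈ Finset.range m, max (p.2 j) 0 / (totalRate ω (p.1 j)).toReal))) := by
    rw [Finset.mul_sum, ← Finset.sum_neg_distrib, Real.exp_sum,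
      ENNReal.ofReal_prod_of_nonneg fun j _ => (Real.exp_pos _).le]
    refine Finset.prod_congr rfl fun j hj => ?_
    rw [if_pos (hQ j (Finset.mem_range.1 hj))]
    congr 3
    ring
  rw [hD]
  gcongr

/-- If at some time before `t` the walk is not in `Q` (possibly because it has exploded), then
either some jump leads out of `Q` before time `t`, or all the jumps occur before time `t`. -/
lemma exists_notMem_or_forall_jumpTime_le {ω : Environment} {p : PathSpace} {Q : Set (ℤ × ℤ)}
    {s t : ℝ} (hst : s ≤ t) (hs : ∀ x ∈ Q, walk ω p s ≠ some x) :
    (∃ m, p.1 m ∉ Q ∧ jumpTime ω p m ≤ ENNReal.ofReal t)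
      ∨ ∀ m, jumpTime ω p m ≤ ENNReal.ofReal t := by
  classical
  have hle : ENNReal.ofReal s ≤ ENNReal.ofReal t := ENNReal.ofReal_le_ofReal hst
  by_cases hex : ∃ n : ℕ, ENNReal.ofReal s < jumpTime ω p (n + 1)
  · left
    refine ⟨Nat.find hex, fun hmem => hs _ hmem ?_, ?_⟩
    · rw [walk, dif_pos hex]
    · rcases hN : Nat.find hex with _ | k
      · simp [jumpTime]
      · have := Nat.find_min hex (m := k) (by omega)
        exact (not_lt.1 this).trans hle
  · right
    push Not at hex
    intro m
    rcases m with _ | k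
    · simp [jumpTime]
    · exact (hex k).trans hle

open Classical in
/-- The exponential Markov inequality for the exit time from `Q`. -/
lemma quenchedLaw_exit_le {h v : ℤ → ℝ} (hh : ∀ k, 0 < h k) (hv : ∀ k, 0 < v k) {ρ : ℝ}
    (hρ : 0 < ρ) (Q : Set (ℤ × ℤ)) (n : ℕ) {t : ℝ} (ht : 0 ≤ t) :
    quenchedLaw (lineEnvironment h v)
        {p | ∃ s ≤ t, ∀ x ∈ Q, walk (lineEnvironment h v) p s ≠ some x}
      ≤ ENNReal.ofReal (Real.exp (ρ * t) * exitTransform h v ρ Q n (0, 0)) := by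
  set ω := lineEnvironment h v with hωdef
  have hω : ∀ x, 0 < (totalRate ω x).toReal := fun x => by
    rw [toReal_totalRate_lineEnvironment hh hv]; linarith [hh x.2, hv x.1]
  set Z : PathSpace → ℝ≥0∞ := fun p =>
    ∑ m ∈ Finset.range n, discount ω ρ Q m p * Qᶜ.indicator 1 (p.1 m) + discount ω ρ Q n p * 1
    with hZ
  have hm1 : ∀ m, Measurable fun p : PathSpace =>
      discount ω ρ Q m p * Qᶜ.indicator (1 : ℤ × ℤ → ℝ≥0∞) (p.1 m) := fun m =>
    (measurable_discount ω ρ Q m).mul (Measurable.comp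
      (g := Qᶜ.indicator (1 : ℤ × ℤ → ℝ≥0∞)) (f := fun p : PathSpace => p.1 m)
      (measurable_of_countable _) ((measurable_pi_apply m).comp measurable_fst))
  have hZm : Measurable Z :=
    (Finset.measurable_fun_sum _ fun m _ => hm1 m).add ((measurable_discount ω ρ Q n).mul_const 1)
  have hZint : ∫⁻ p, Z p ∂quenchedLaw ω = ENNReal.ofReal (exitTransform h v ρ Q n (0, 0)) := by
    have h1 := congrFun (ofReal_exitTransform hh hv hρ Q n) (0, 0)
    simp only [Pi.add_apply, Finset.sum_apply] at h1
    rw [h1, hZ, lintegral_add_left (Finset.measurable_fun_sum _ fun m _ => hm1 m),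
      lintegral_finsetSum _ fun m _ => hm1 m]
    congr 1
    · exact Finset.sum_congr rfl fun m _ => lintegral_discount_mul ω hρ hω Q m _
    · exact lintegral_discount_mul ω hρ hω Q n 1
  have hsub : {p | ∃ s ≤ t, ∀ x ∈ Q, walk ω p s ≠ some x}
      ⊆ {p | ENNReal.ofReal (Real.exp (-(ρ * t))) ≤ Z p} := by
    rintro p ⟨s, hst, hs⟩
    have hcase := exists_notMem_or_forall_jumpTime_le hst hs
    -- the first exit from `Q` takes place before the `n`-th jump, or not
    by_cases hex : ∃ m, m < n ∧ p.1 m ∉ Q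
    · have hspec := Nat.find_spec hex
      have hin : ∀ j < Nat.find hex, p.1 j ∈ Q := fun j hj => by
        by_contra hj'
        exact Nat.find_min hex hj ⟨hj.trans hspec.1, hj'⟩
      have hJ : jumpTime ω p (Nat.find hex) ≤ ENNReal.ofReal t := by
        rcases hcase with ⟨m, hmQ, hmJ⟩ | hall
        · refine (jumpTime_mono ω p ?_).trans hmJ
          by_contra hlt
          exact hmQ (hin m (not_le.1 hlt))
        · exact hall _
      calc ENNReal.ofReal (Real.exp (-(ρ * t)))
          ≤ discount ω ρ Q (Nat.find hex) p * Qᶜ.indicator 1 (p.1 (Nat.find hex)) := by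
            rw [Set.indicator_of_mem (by exact hspec.2), Pi.one_apply, mul_one]
            exact ofReal_exp_le_discount hω hρ hin ht hJ
        _ ≤ ∑ m ∈ Finset.range n, discount ω ρ Q m p * Qᶜ.indicator 1 (p.1 m) :=
            Finset.single_le_sum
              (f := fun m => discount ω ρ Q m p * Qᶜ.indicator (1 : ℤ × ℤ → ℝ≥0∞) (p.1 m))
              (fun _ _ => zero_le) (Finset.mem_range.2 hspec.1)
        _ ≤ Z p := le_self_add
    · push Not at hex
      have hJ : jumpTime ω p n ≤ ENNReal.ofReal t := by
        rcases hcase with ⟨m, hmQ, hmJ⟩ | hall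
        · refine (jumpTime_mono ω p ?_).trans hmJ
          by_contra hlt
          exact hmQ (hex m (not_le.1 hlt))
        · exact hall _
      calc ENNReal.ofReal (Real.exp (-(ρ * t))) ≤ discount ω ρ Q n p * 1 := by
            rw [mul_one]; exact ofReal_exp_le_discount hω hρ hex ht hJ
        _ ≤ Z p := le_add_self
  have hmarkov := mul_meas_ge_le_lintegral (μ := quenchedLaw ω) hZm
    (ENNReal.ofReal (Real.exp (-(ρ * t))))
  rw [hZint] at hmarkov
  have hone : ENNReal.ofReal (Real.exp (ρ * t)) * ENNReal.ofReal (Real.exp (-(ρ * t))) = 1 := by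
    rw [← ENNReal.ofReal_mul (Real.exp_pos _).le, ← Real.exp_add, add_neg_cancel, Real.exp_zero,
      ENNReal.ofReal_one]
  calc quenchedLaw ω {p | ∃ s ≤ t, ∀ x ∈ Q, walk ω p s ≠ some x}
      ≤ quenchedLaw ω {p | ENNReal.ofReal (Real.exp (-(ρ * t))) ≤ Z p} := measure_mono hsub
    _ = ENNReal.ofReal (Real.exp (ρ * t)) * (ENNReal.ofReal (Real.exp (-(ρ * t)))
        * quenchedLaw ω {p | ENNReal.ofReal (Real.exp (-(ρ * t))) ≤ Z p}) := by
        rw [← mul_assoc, hone, one_mul]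
    _ ≤ ENNReal.ofReal (Real.exp (ρ * t)) * ENNReal.ofReal (exitTransform h v ρ Q n (0, 0)) := by
        gcongr
    _ = _ := (ENNReal.ofReal_mul (Real.exp_pos _).le).symm

/-! ### Monotonicity, translation and limit of the exit transform -/


lemma exitTransform_le_one {h v : ℤ → ℝ} (hh : ∀ k, 0 < h k) (hv : ∀ k, 0 < v k) {ρ : ℝ}
    (hρ : 0 < ρ) (Q : Set (ℤ × ℤ)) (n : ℕ) (x : ℤ × ℤ) : exitTransform h v ρ Q n x ≤ 1 := by
  induction n generalizing x with
  | zero => simp [exitTransform]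
  | succ n ih =>
    rw [exitTransform]
    split_ifs
    · have h1 := hh x.2
      have h2 := hv x.1
      rw [div_le_one (by positivity)]
      nlinarith [ih (x.1 + 1, x.2), ih (x.1 - 1, x.2), ih (x.1, x.2 + 1), ih (x.1, x.2 - 1)]
    · exact le_rfl

lemma exitTransform_antitone {h v : ℤ → ℝ} (hh : ∀ k, 0 < h k) (hv : ∀ k, 0 < v k) {ρ : ℝ}
    (hρ : 0 < ρ) (Q : Set (ℤ × ℤ)) (x : ℤ × ℤ) :
    Antitone fun n => exitTransform h v ρ Q n x := by
  refine antitone_nat_of_succ_le fun n => ?_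
  induction n generalizing x with
  | zero => exact exitTransform_le_one hh hv hρ Q 1 x
  | succ n ih =>
    by_cases hx : x ∈ Q
    · rw [exitTransform_succ_of_mem h v ρ (n + 1) hx, exitTransform_succ_of_mem h v ρ n hx]
      have h1 := hh x.2
      have h2 := hv x.1
      have i1 := ih (x.1 + 1, x.2)
      have i2 := ih (x.1 - 1, x.2)
      have i3 := ih (x.1, x.2 + 1)
      have i4 := ih (x.1, x.2 - 1)
      gcongr
    · rw [exitTransform_succ_of_notMem h v ρ (n + 1) hx, exitTransform_succ_of_notMem h v ρ n hx]

/-- The exit from a larger set occurs later. -/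
lemma exitTransform_anti_set {h v : ℤ → ℝ} (hh : ∀ k, 0 < h k) (hv : ∀ k, 0 < v k) {ρ : ℝ}
    (hρ : 0 < ρ) {Q Q' : Set (ℤ × ℤ)} (hQ : Q ⊆ Q') (n : ℕ) (x : ℤ × ℤ) :
    exitTransform h v ρ Q' n x ≤ exitTransform h v ρ Q n x := by
  induction n generalizing x with
  | zero => exact le_rfl
  | succ n ih =>
    by_cases hx : x ∈ Q
    · rw [exitTransform, exitTransform, if_pos hx, if_pos (hQ hx)]
      have h1 := hh x.2
      have h2 := hv x.1
      have i1 := ih (x.1 + 1, x.2)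
      have i2 := ih (x.1 - 1, x.2)
      have i3 := ih (x.1, x.2 + 1)
      have i4 := ih (x.1, x.2 - 1)
      gcongr
    · refine (exitTransform_le_one hh hv hρ Q' (n + 1) x).trans ?_
      rw [exitTransform, if_neg hx]

lemma exitTransform_shift (h v : ℤ → ℝ) (ρ : ℝ) (Q : Set (ℤ × ℤ)) (z : ℤ × ℤ) (n : ℕ)
    (x : ℤ × ℤ) :
    exitTransform (fun k => h (k + z.2)) (fun k => v (k + z.1)) ρ Q n x
      = exitTransform h v ρ {y | y - z ∈ Q} n (x + z) := by
  induction n generalizing x with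
  | zero => rfl
  | succ n ih =>
    have e1 : (x.1 + 1, x.2) + z = (x.1 + z.1 + 1, x.2 + z.2) := by
      ext <;> simp [add_right_comm]
    have e2 : (x.1 - 1, x.2) + z = (x.1 + z.1 - 1, x.2 + z.2) := by
      ext <;> simp [sub_add_eq_add_sub]
    have e3 : (x.1, x.2 + 1) + z = (x.1 + z.1, x.2 + z.2 + 1) := by
      ext <;> simp [add_right_comm]
    have e4 : (x.1, x.2 - 1) + z = (x.1 + z.1, x.2 + z.2 - 1) := by
      ext <;> simp [sub_add_eq_add_sub]
    have e0 : x + z ∈ {y | y - z ∈ Q} ↔ x ∈ Q := by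
      change x + z - z ∈ Q ↔ x ∈ Q
      rw [add_sub_cancel_right]
    by_cases hx : x ∈ Q
    · rw [exitTransform_succ_of_mem _ _ _ n hx, exitTransform_succ_of_mem _ _ _ n (e0.2 hx)]
      simp only [ih, e1, e2, e3, e4, Prod.fst_add, Prod.snd_add]
    · rw [exitTransform_succ_of_notMem _ _ _ n hx,
        exitTransform_succ_of_notMem _ _ _ n (mt e0.1 hx)]

lemma measurable_exitTransform (ρ : ℝ) (Q : Set (ℤ × ℤ)) (n : ℕ) (x : ℤ × ℤ) :
    Measurable fun w : (ℤ → ℝ) × (ℤ → ℝ) => exitTransform w.1 w.2 ρ Q n x := by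
  have m1 : ∀ k : ℤ, Measurable fun w : (ℤ → ℝ) × (ℤ → ℝ) => w.1 k := fun k =>
    (measurable_pi_apply k).comp measurable_fst
  have m2 : ∀ k : ℤ, Measurable fun w : (ℤ → ℝ) × (ℤ → ℝ) => w.2 k := fun k =>
    (measurable_pi_apply k).comp measurable_snd
  induction n generalizing x with
  | zero => exact measurable_const
  | succ n ih =>
    by_cases hx : x ∈ Q
    · simp only [exitTransform, if_pos hx]
      exact (((m1 _).mul ((ih _).add (ih _))).add ((m2 _).mul ((ih _).add (ih _)))).div
        ((((m1 _).const_mul 2).add ((m2 _).const_mul 2)).add_const ρ)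
    · simp only [exitTransform, if_neg hx]
      exact measurable_const

/-- The function `x ↦ E_x[exp (-ρ J)]`, where `J` is the time at which the walk in the line
environment leaves `Q` or explodes. -/
noncomputable def exitLimit (h v : ℤ → ℝ) (ρ : ℝ) (Q : Set (ℤ × ℤ)) (x : ℤ × ℤ) : ℝ :=
  ⨅ n, exitTransform h v ρ Q n x

section ExitLimit

variable {h v : ℤ → ℝ} {ρ : ℝ}

lemma bddBelow_exitTransform (hh : ∀ k, 0 < h k) (hv : ∀ k, 0 < v k) (hρ : 0 < ρ)
    (Q : Set (ℤ × ℤ)) (x : ℤ × ℤ) :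
    BddBelow (Set.range fun n => exitTransform h v ρ Q n x) :=
  ⟨0, by rintro _ ⟨n, rfl⟩; exact exitTransform_nonneg hh hv hρ Q n x⟩

lemma tendsto_exitTransform (hh : ∀ k, 0 < h k) (hv : ∀ k, 0 < v k) (hρ : 0 < ρ)
    (Q : Set (ℤ × ℤ)) (x : ℤ × ℤ) :
    Tendsto (fun n => exitTransform h v ρ Q n x) atTop (𝓝 (exitLimit h v ρ Q x)) :=
  tendsto_atTop_ciInf (exitTransform_antitone hh hv hρ Q x) (bddBelow_exitTransform hh hv hρ Q x)

lemma exitLimit_nonneg (hh : ∀ k, 0 < h k) (hv : ∀ k, 0 < v k) (hρ : 0 < ρ)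
    (Q : Set (ℤ × ℤ)) (x : ℤ × ℤ) : 0 ≤ exitLimit h v ρ Q x :=
  le_ciInf fun n => exitTransform_nonneg hh hv hρ Q n x

lemma exitLimit_le_one (hh : ∀ k, 0 < h k) (hv : ∀ k, 0 < v k) (hρ : 0 < ρ)
    (Q : Set (ℤ × ℤ)) (x : ℤ × ℤ) : exitLimit h v ρ Q x ≤ 1 :=
  ciInf_le (bddBelow_exitTransform hh hv hρ Q x) 0

/-- In the environment seen from `z`, leaving `Q'` from the origin takes longer than leaving
`Q` from `z` in the original environment, provided that `Q ⊆ z + Q'`. -/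
lemma exitLimit_shift_le (hh : ∀ k, 0 < h k) (hv : ∀ k, 0 < v k) (hρ : 0 < ρ)
    {Q Q' : Set (ℤ × ℤ)} {z : ℤ × ℤ} (hQ : ∀ y ∈ Q, y - z ∈ Q') :
    exitLimit (fun k => h (k + z.2)) (fun k => v (k + z.1)) ρ Q' (0, 0) ≤ exitLimit h v ρ Q z := by
  refine le_of_tendsto_of_tendsto
    (tendsto_exitTransform (fun k => hh _) (fun k => hv _) hρ Q' (0, 0))
    (tendsto_exitTransform hh hv hρ Q z) (Eventually.of_forall fun n => ?_)
  simp only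
  rw [exitTransform_shift]
  have e : ((0 : ℤ), (0 : ℤ)) + z = z := by ext <;> simp
  rw [e]
  exact exitTransform_anti_set hh hv hρ hQ n z

lemma measurable_exitLimit (ρ : ℝ) (Q : Set (ℤ × ℤ)) (x : ℤ × ℤ) :
    Measurable fun w : (ℤ → ℝ) × (ℤ → ℝ) => exitLimit w.1 w.2 ρ Q x :=
  Measurable.iInf fun n => measurable_exitTransform ρ Q n x

/-- The resolvent equation `ρ g = L g` in `Q`. -/
lemma exitLimit_resolvent (hh : ∀ k, 0 < h k) (hv : ∀ k, 0 < v k) (hρ : 0 < ρ)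
    {Q : Set (ℤ × ℤ)} {x : ℤ × ℤ} (hx : x ∈ Q) :
    ρ * exitLimit h v ρ Q x
      = h x.2 * (exitLimit h v ρ Q (x.1 + 1, x.2) + exitLimit h v ρ Q (x.1 - 1, x.2)
          - 2 * exitLimit h v ρ Q x)
        + v x.1 * (exitLimit h v ρ Q (x.1, x.2 + 1) + exitLimit h v ρ Q (x.1, x.2 - 1)
          - 2 * exitLimit h v ρ Q x) := by
  have hlim := tendsto_exitTransform hh hv hρ Q
  have h1 := ((((hlim (x.1 + 1, x.2)).add (hlim (x.1 - 1, x.2))).const_mul (h x.2)).add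
    (((hlim (x.1, x.2 + 1)).add (hlim (x.1, x.2 - 1))).const_mul (v x.1))).div_const
      (2 * h x.2 + 2 * v x.1 + ρ)
  have h2 := (hlim x).comp (tendsto_add_atTop_nat 1)
  have h3 : (fun n => exitTransform h v ρ Q n x) ∘ (fun n => n + 1)
      = fun n => (h x.2 * (exitTransform h v ρ Q n (x.1 + 1, x.2)
            + exitTransform h v ρ Q n (x.1 - 1, x.2))
          + v x.1 * (exitTransform h v ρ Q n (x.1, x.2 + 1)
            + exitTransform h v ρ Q n (x.1, x.2 - 1))) / (2 * h x.2 + 2 * v x.1 + ρ) := by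
    ext n
    simp only [Function.comp, exitTransform, if_pos hx]
  rw [h3] at h2
  have h4 := tendsto_nhds_unique h2 h1
  have p1 := hh x.2
  have p2 := hv x.1
  rw [eq_div_iff (by positivity)] at h4
  linarith

end ExitLimit

/-! ### The energy estimate -/

lemma sum_Icc_sub_pred (F : ℤ → ℝ) (a : ℤ) (n : ℕ) :
    ∑ x ∈ Finset.Icc a (a + n), (F x - F (x - 1)) = F (a + n) - F (a - 1) := by
  induction n with
  | zero => simp
  | succ n ih =>
    have e : Finset.Icc a (a + (n + 1 : ℕ)) = insert (a + (n + 1 : ℕ)) (Finset.Icc a (a + n)) := by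
      ext y; simp only [Finset.mem_insert, Finset.mem_Icc]; push_cast; omega
    rw [e, Finset.sum_insert (by simp), ih]
    push_cast
    rw [show a + ((n : ℤ) + 1) - 1 = a + n by ring]
    ring

/-- Summation by parts against the test function `η² g`: the edge `{x, x + 1}` contributes
`-((η g)(x + 1) - (η g)(x))²`, which is dropped, plus `g x * g (x + 1) * (η (x + 1) - η x)²`, which
is at most `(η (x + 1) - η x)²` since `0 ≤ g ≤ 1`. -/
lemma sum_sq_mul_laplacian_le {g η : ℤ → ℝ} (g0 : ∀ x, 0 ≤ g x) (g1 : ∀ x, g x ≤ 1) {M : ℕ}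
    (hl : η (-M) = 0) (hr : η (M + 1) = 0) :
    ∑ x ∈ Finset.Icc (-M : ℤ) M, η x ^ 2 * g x * (g (x + 1) + g (x - 1) - 2 * g x)
      ≤ ∑ x ∈ Finset.Icc (-M : ℤ) M, (η (x + 1) - η x) ^ 2 := by
  set F : ℤ → ℝ := fun x => (g (x + 1) - g x) * η (x + 1) ^ 2 * g (x + 1) with hF
  have htel : ∑ x ∈ Finset.Icc (-M : ℤ) M, (F x - F (x - 1)) = 0 := by
    have := sum_Icc_sub_pred F (-M) (2 * M)
    have e : (-M : ℤ) + (2 * M : ℕ) = M := by push_cast; ring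
    rw [e] at this
    rw [this]
    simp [hF, hl, hr]
  have hterm : ∀ x, η x ^ 2 * g x * (g (x + 1) + g (x - 1) - 2 * g x)
      ≤ (η (x + 1) - η x) ^ 2 + (F x - F (x - 1)) := by
    intro x
    have e : F x - F (x - 1) - η x ^ 2 * g x * (g (x + 1) + g (x - 1) - 2 * g x)
        = (η (x + 1) * g (x + 1) - η x * g x) ^ 2
          - g x * g (x + 1) * (η (x + 1) - η x) ^ 2 := by
      simp only [hF, sub_add_cancel]; ring
    have hgg : g x * g (x + 1) ≤ 1 := mul_le_one₀ (g1 x) (g0 _) (g1 _)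
    nlinarith [sq_nonneg (η (x + 1) * g (x + 1) - η x * g x), sq_nonneg (η (x + 1) - η x)]
  calc _ ≤ ∑ x ∈ Finset.Icc (-M : ℤ) M, ((η (x + 1) - η x) ^ 2 + (F x - F (x - 1))) :=
        Finset.sum_le_sum fun x _ => hterm x
    _ = _ := by rw [Finset.sum_add_distrib, htel, add_zero]

/-- The tent function of height `1` supported by `[-M, M]`. -/
noncomputable def tent (M : ℕ) (x : ℤ) : ℝ := max 0 (1 - |(x : ℝ)| / M)

lemma tent_nonneg (M : ℕ) (x : ℤ) : 0 ≤ tent M x := le_max_left _ _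

lemma tent_le_one (M : ℕ) (x : ℤ) : tent M x ≤ 1 :=
  max_le zero_le_one (by have : 0 ≤ |(x : ℝ)| / M := by positivity
                         linarith)

lemma tent_eq_zero {M : ℕ} (hM : 0 < M) {x : ℤ} (hx : (M : ℤ) ≤ |x|) : tent M x = 0 := by
  have h1 : (M : ℝ) ≤ |(x : ℝ)| := by exact_mod_cast hx
  have h2 : (0 : ℝ) < M := by exact_mod_cast hM
  have h3 : 1 ≤ |(x : ℝ)| / M := by rwa [one_le_div h2]
  exact max_eq_left (by linarith)

lemma half_le_tent {N : ℕ} (hN : 0 < N) {x : ℤ} (hx : |x| ≤ N) : 1 / 2 ≤ tent (2 * N) x := by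
  have h1 : |(x : ℝ)| ≤ N := by exact_mod_cast hx
  have h2 : (0 : ℝ) < N := by exact_mod_cast hN
  refine le_max_of_le_right ?_
  have : |(x : ℝ)| / ((2 * N : ℕ) : ℝ) ≤ 1 / 2 := by
    push_cast
    rw [div_le_div_iff₀ (by positivity) two_pos]
    linarith
  linarith

lemma sq_tent_succ_sub_le (M : ℕ) (x : ℤ) : (tent M (x + 1) - tent M x) ^ 2 ≤ 1 / (M : ℝ) ^ 2 := by
  have h : |tent M (x + 1) - tent M x| ≤ 1 / (M : ℝ) := by
    unfold tent
    refine (abs_max_sub_max_le_max _ _ _ _).trans (max_le (by simp) ?_)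
    rw [show (1 - |((x + 1 : ℤ) : ℝ)| / M) - (1 - |(x : ℝ)| / M)
      = (|(x : ℝ)| - |((x + 1 : ℤ) : ℝ)|) / M by ring, abs_div, Nat.abs_cast]
    gcongr
    refine (abs_abs_sub_abs_le _ _).trans ?_
    push_cast
    simp
  rw [← sq_abs, ← one_div_pow]
  gcongr

lemma sum_tent_sq_mul_laplacian_le {g : ℤ → ℝ} (g0 : ∀ x, 0 ≤ g x) (g1 : ∀ x, g x ≤ 1) {N : ℕ}
    (hN : 0 < N) :
    ∑ x ∈ Finset.Icc (-(2 * N : ℕ) : ℤ) (2 * N : ℕ),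
        tent (2 * N) x ^ 2 * g x * (g (x + 1) + g (x - 1) - 2 * g x) ≤ (2 : ℝ) / N := by
  have hN' : (1 : ℝ) ≤ N := by exact_mod_cast hN
  refine (sum_sq_mul_laplacian_le g0 g1 (tent_eq_zero (by omega) (by simp))
    (tent_eq_zero (by omega) (by rw [abs_of_nonneg (by omega)]; omega))).trans ?_
  refine (Finset.sum_le_sum fun x _ => sq_tent_succ_sub_le (2 * N) x).trans ?_
  rw [Finset.sum_const, Int.card_Icc, nsmul_eq_mul]
  have e : ((((2 * N : ℕ) : ℤ) + 1 - -((2 * N : ℕ) : ℤ)).toNat : ℝ) = 4 * N + 1 := by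
    have : (((2 * N : ℕ) : ℤ) + 1 - -((2 * N : ℕ) : ℤ)).toNat = 4 * N + 1 := by omega
    rw [this]; push_cast; ring
  rw [e]
  push_cast
  rw [mul_one_div, div_le_div_iff₀ (by positivity) (by positivity)]
  nlinarith

/-- The box `[-M₁, M₁] × [-M₂, M₂]` of `ℤ²`. -/
noncomputable def box (M₁ M₂ : ℕ) : Finset (ℤ × ℤ) :=
  Finset.Icc (-M₁ : ℤ) M₁ ×ˢ Finset.Icc (-M₂ : ℤ) M₂

lemma mem_box {M₁ M₂ : ℕ} {x : ℤ × ℤ} : x ∈ box M₁ M₂ ↔ |x.1| ≤ M₁ ∧ |x.2| ≤ M₂ := by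
  simp only [box, Finset.mem_product, Finset.mem_Icc, abs_le]

/-- The Caccioppoli inequality for the exit problem: averaged over the starting point, the
exit probability from a box is controlled by the sums of the conductances of the lines. -/
lemma sum_box_sq_exitLimit_le {h v : ℤ → ℝ} (hh : ∀ k, 0 < h k) (hv : ∀ k, 0 < v k) {ρ : ℝ}
    (hρ : 0 < ρ) {N₁ N₂ : ℕ} (hN₁ : 0 < N₁) (hN₂ : 0 < N₂) :
    ρ * ∑ x ∈ box N₁ N₂, exitLimit h v ρ (box (2 * N₁) (2 * N₂)) x ^ 2
      ≤ 16 * (2 / N₁ * ∑ y ∈ Finset.Icc (-(2 * N₂ : ℕ) : ℤ) (2 * N₂ : ℕ), h y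
        + 2 / N₂ * ∑ y ∈ Finset.Icc (-(2 * N₁ : ℕ) : ℤ) (2 * N₁ : ℕ), v y) := by
  set g := exitLimit h v ρ (box (2 * N₁) (2 * N₂)) with hg
  have g0 : ∀ x, 0 ≤ g x := exitLimit_nonneg hh hv hρ _
  have g1 : ∀ x, g x ≤ 1 := exitLimit_le_one hh hv hρ _
  set I₁ := Finset.Icc (-(2 * N₁ : ℕ) : ℤ) (2 * N₁ : ℕ) with hI₁
  set I₂ := Finset.Icc (-(2 * N₂ : ℕ) : ℤ) (2 * N₂ : ℕ) with hI₂
  set η₁ := tent (2 * N₁)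
  set η₂ := tent (2 * N₂)
  have hpt : ∀ x ∈ box (2 * N₁) (2 * N₂), ρ * (η₁ x.1 ^ 2 * η₂ x.2 ^ 2 * g x ^ 2)
      = h x.2 * η₂ x.2 ^ 2 * (η₁ x.1 ^ 2 * g x * (g (x.1 + 1, x.2) + g (x.1 - 1, x.2) - 2 * g x))
        + v x.1 * η₁ x.1 ^ 2
          * (η₂ x.2 ^ 2 * g x * (g (x.1, x.2 + 1) + g (x.1, x.2 - 1) - 2 * g x)) := by
    intro x hx
    have := exitLimit_resolvent hh hv hρ (Finset.mem_coe.2 hx)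
    rw [← hg] at this
    linear_combination (η₁ x.1 ^ 2 * η₂ x.2 ^ 2 * g x) * this
  have hsub : box N₁ N₂ ⊆ box (2 * N₁) (2 * N₂) := fun x hx => by
    rw [mem_box] at hx ⊢
    push_cast
    constructor <;> linarith [hx.1, hx.2, abs_nonneg x.1, abs_nonneg x.2]
  have hinner : ∀ x ∈ box N₁ N₂, g x ^ 2 ≤ 16 * (η₁ x.1 ^ 2 * η₂ x.2 ^ 2 * g x ^ 2) := by
    intro x hx
    rw [mem_box] at hx
    have e1 : 1 / 4 ≤ η₁ x.1 ^ 2 := by nlinarith [half_le_tent hN₁ hx.1]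
    have e2 : 1 / 4 ≤ η₂ x.2 ^ 2 := by nlinarith [half_le_tent hN₂ hx.2]
    have e3 : 1 / 16 ≤ η₁ x.1 ^ 2 * η₂ x.2 ^ 2 := by nlinarith
    nlinarith [sq_nonneg (g x)]
  have hrow : ∑ x ∈ box (2 * N₁) (2 * N₂), h x.2 * η₂ x.2 ^ 2
      * (η₁ x.1 ^ 2 * g x * (g (x.1 + 1, x.2) + g (x.1 - 1, x.2) - 2 * g x))
        ≤ 2 / N₁ * ∑ y ∈ I₂, h y := by
    rw [box, Finset.sum_product_right, Finset.mul_sum]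
    refine Finset.sum_le_sum fun y _ => ?_
    simp only
    rw [← Finset.mul_sum]
    have hb := sum_tent_sq_mul_laplacian_le (g := fun a => g (a, y)) (fun a => g0 _)
      (fun a => g1 _) hN₁
    have hη : η₂ y ^ 2 ≤ 1 := pow_le_one₀ (tent_nonneg _ _) (tent_le_one _ _)
    have hN : (0 : ℝ) ≤ 2 / N₁ := by positivity
    calc _ ≤ h y * η₂ y ^ 2 * (2 / N₁) :=
          mul_le_mul_of_nonneg_left hb (mul_nonneg (hh y).le (sq_nonneg _))
      _ ≤ 2 / N₁ * h y := by
        have := mul_le_mul_of_nonneg_left hη (mul_nonneg hN (hh y).le)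
        linarith
  have hcol : ∑ x ∈ box (2 * N₁) (2 * N₂), v x.1 * η₁ x.1 ^ 2
      * (η₂ x.2 ^ 2 * g x * (g (x.1, x.2 + 1) + g (x.1, x.2 - 1) - 2 * g x))
        ≤ 2 / N₂ * ∑ y ∈ I₁, v y := by
    rw [box, Finset.sum_product, Finset.mul_sum]
    refine Finset.sum_le_sum fun y _ => ?_
    simp only
    rw [← Finset.mul_sum]
    have hb := sum_tent_sq_mul_laplacian_le (g := fun a => g (y, a)) (fun a => g0 _)
      (fun a => g1 _) hN₂
    have hη : η₁ y ^ 2 ≤ 1 := pow_le_one₀ (tent_nonneg _ _) (tent_le_one _ _)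
    have hN : (0 : ℝ) ≤ 2 / N₂ := by positivity
    calc _ ≤ v y * η₁ y ^ 2 * (2 / N₂) :=
          mul_le_mul_of_nonneg_left hb (mul_nonneg (hv y).le (sq_nonneg _))
      _ ≤ 2 / N₂ * v y := by
        have := mul_le_mul_of_nonneg_left hη (mul_nonneg hN (hv y).le)
        linarith
  calc ρ * ∑ x ∈ box N₁ N₂, g x ^ 2
      ≤ ρ * ∑ x ∈ box N₁ N₂, 16 * (η₁ x.1 ^ 2 * η₂ x.2 ^ 2 * g x ^ 2) := by
        gcongr with x hx; exact hinner x hx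
    _ ≤ ρ * ∑ x ∈ box (2 * N₁) (2 * N₂), 16 * (η₁ x.1 ^ 2 * η₂ x.2 ^ 2 * g x ^ 2) := by
        gcongr
    _ = 16 * ∑ x ∈ box (2 * N₁) (2 * N₂), ρ * (η₁ x.1 ^ 2 * η₂ x.2 ^ 2 * g x ^ 2) := by
        rw [Finset.mul_sum, Finset.mul_sum]
        exact Finset.sum_congr rfl fun x _ => by ring
    _ ≤ _ := by
        rw [Finset.sum_congr rfl hpt, Finset.sum_add_distrib]
        gcongr

/-! ### Fractional moments -/

lemma sum_rpow_le_sum_rpow {ι : Type*} (s : Finset ι) {f : ι → ℝ} (hf : ∀ i, 0 ≤ f i) {β : ℝ}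
    (hβ₀ : 0 < β) (hβ₁ : β ≤ 1) : (∑ i ∈ s, f i) ^ β ≤ ∑ i ∈ s, f i ^ β := by
  classical
  induction s using Finset.induction_on with
  | empty => simp [Real.zero_rpow hβ₀.ne']
  | insert i s hi ih =>
    rw [Finset.sum_insert hi, Finset.sum_insert hi]
    refine (Real.rpow_add_le_add_rpow (hf i) (Finset.sum_nonneg fun j _ => hf j) hβ₀.le
      hβ₁).trans ?_
    gcongr

lemma HasTailExponent.lintegral_rpow_lt_top {Ω : Type*} [MeasurableSpace Ω] {P : Measure Ω}
    [IsProbabilityMeasure P] {Y : Ω → ℝ} {α : ℝ} (hα : HasTailExponent P Y α)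
    (hYm : Measurable Y) (hY : 0 ≤ᵐ[P] Y) {β : ℝ} (hβ₀ : 0 < β) (hβ : β < α) :
    ∫⁻ e, ENNReal.ofReal (Y e ^ β) ∂P < ∞ := by
  obtain ⟨c, hc, r, hr, htail⟩ := hα
  have hα₀ : 0 < α := hβ₀.trans hβ
  set γ := (α + β) / 2 with hγ
  have hr' : ∀ᶠ L in atTop, γ ≤ α * (1 + r L) := by
    have h1 : Tendsto (fun L => α * (1 + r L)) atTop (𝓝 (α * (1 + 0))) :=
      (hr.const_add 1).const_mul α
    exact h1.eventually (Ici_mem_nhds (by rw [hγ]; linarith))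
  obtain ⟨L₀, hL₀⟩ := eventually_atTop.1 ((htail.and hr').and (eventually_ge_atTop 1))
  have hL₀1 : 1 ≤ L₀ := (hL₀ L₀ le_rfl).2
  have hbound : ∀ t ∈ Set.Ioi L₀, P {e | t < Y e} * ENNReal.ofReal (t ^ (β - 1))
      ≤ ENNReal.ofReal (c * t ^ (β - 1 - γ)) := by
    intro t ht
    obtain ⟨⟨h1, h2⟩, h3⟩ := hL₀ t (le_of_lt ht)
    have ht0 : 0 < t := by linarith
    rw [← ofReal_measureReal, h1, ← ENNReal.ofReal_mul (by positivity)]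
    apply ENNReal.ofReal_le_ofReal
    rw [mul_assoc, ← Real.rpow_add ht0]
    gcongr
    linarith
  rw [lintegral_rpow_eq_lintegral_meas_lt_mul P hY hYm.aemeasurable hβ₀]
  refine ENNReal.mul_lt_top ENNReal.ofReal_lt_top ?_
  rw [← Set.Ioc_union_Ioi_eq_Ioi (show (0 : ℝ) ≤ L₀ by linarith)]
  refine (lintegral_union_le _ _ _).trans_lt (ENNReal.add_lt_top.2 ⟨?_, ?_⟩)
  · calc ∫⁻ t in Set.Ioc 0 L₀, P {e | t < Y e} * ENNReal.ofReal (t ^ (β - 1))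
        ≤ ∫⁻ t in Set.Ioc 0 L₀, ENNReal.ofReal (t ^ (β - 1)) :=
          lintegral_mono fun t => mul_le_of_le_one_left zero_le prob_le_one
      _ < ∞ := by
        have hi : IntervalIntegrable (fun t : ℝ => t ^ (β - 1)) volume 0 L₀ :=
          intervalIntegral.intervalIntegrable_rpow' (by linarith)
        rw [intervalIntegrable_iff_integrableOn_Ioc_of_le (by linarith)] at hi
        exact hi.lintegral_lt_top
  · calc ∫⁻ t in Set.Ioi L₀, P {e | t < Y e} * ENNReal.ofReal (t ^ (β - 1))
        ≤ ∫⁻ t in Set.Ioi L₀, ENNReal.ofReal (c * t ^ (β - 1 - γ)) :=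
          setLIntegral_mono' measurableSet_Ioi hbound
      _ < ∞ := by
        have hi : IntegrableOn (fun t : ℝ => c * t ^ (β - 1 - γ)) (Set.Ioi L₀) :=
          (integrableOn_Ioi_rpow_of_lt (by rw [hγ]; linarith) (by linarith)).const_mul c
        exact hi.lintegral_lt_top

lemma lintegral_sum_rpow_le {Ω : Type*} [MeasurableSpace Ω] {P : Measure Ω} {Y : ℤ → Ω → ℝ}
    (hm : ∀ k, Measurable (Y k)) (hid : ∀ k, IdentDistrib (Y k) (Y 0) P P)
    (hpos : ∀ᵐ e ∂P, ∀ k, 0 < Y k e) {β : ℝ} (hβ₀ : 0 < β) (hβ₁ : β ≤ 1) (s : Finset ℤ) :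
    ∫⁻ e, ENNReal.ofReal ((∑ k ∈ s, Y k e) ^ β) ∂P
      ≤ s.card * ∫⁻ e, ENNReal.ofReal (Y 0 e ^ β) ∂P := by
  have hu : Measurable fun y : ℝ => ENNReal.ofReal (y ^ β) := by fun_prop
  calc ∫⁻ e, ENNReal.ofReal ((∑ k ∈ s, Y k e) ^ β) ∂P
      ≤ ∫⁻ e, ∑ k ∈ s, ENNReal.ofReal (Y k e ^ β) ∂P := by
        refine lintegral_mono_ae (hpos.mono fun e he => ?_)
        rw [← ENNReal.ofReal_sum_of_nonneg fun k _ => Real.rpow_nonneg (he k).le _]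
        exact ENNReal.ofReal_le_ofReal (sum_rpow_le_sum_rpow s (fun k => (he k).le) hβ₀ hβ₁)
    _ = ∑ k ∈ s, ∫⁻ e, ENNReal.ofReal (Y k e ^ β) ∂P :=
        lintegral_finsetSum _ fun k _ => hu.comp (hm k)
    _ = ∑ _k ∈ s, ∫⁻ e, ENNReal.ofReal (Y 0 e ^ β) ∂P :=
        Finset.sum_congr rfl fun k _ => ((hid k).comp hu).lintegral_eq
    _ = _ := by rw [Finset.sum_const, nsmul_eq_mul]

/-! ### Stationarity of the environment -/

lemma map_shift_eq {Ω : Type*} [MeasurableSpace Ω] {P : Measure Ω} [IsProbabilityMeasure P]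
    {Y : ℤ → Ω → ℝ} (hm : ∀ k, Measurable (Y k)) (hind : iIndepFun Y P)
    (hid : ∀ k, IdentDistrib (Y k) (Y 0) P P) (a : ℤ) :
    P.map (fun e k => Y (k + a) e) = P.map (fun e k => Y k e) := by
  have hind' : iIndepFun (fun k => Y (k + a)) P := hind.precomp (add_left_injective a)
  rw [hind.map_fun_eq_infinitePi_map hm, hind'.map_fun_eq_infinitePi_map fun k => hm (k + a)]
  congr 1
  ext1 k
  rw [(hid (k + a)).map_eq, (hid k).map_eq]

/-- The joint law of the conductances is invariant under the translations of `ℤ²`; note that a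
translation by `z` shifts the rows by `z.2` and the columns by `z.1`. -/
lemma lintegral_environment_shift {Ω : Type*} [MeasurableSpace Ω] {P : Measure Ω}
    [IsProbabilityMeasure P] {H V : ℤ → Ω → ℝ}
    (hHmeas : ∀ k, Measurable (H k)) (hVmeas : ∀ k, Measurable (V k))
    (hHindep : iIndepFun H P) (hVindep : iIndepFun V P)
    (hHident : ∀ k, IdentDistrib (H k) (H 0) P P) (hVident : ∀ k, IdentDistrib (V k) (V 0) P P)
    (hHV : IndepFun (fun e k => H k e) (fun e k => V k e) P)
    {Φ : (ℤ → ℝ) × (ℤ → ℝ) → ℝ≥0∞} (hΦ : Measurable Φ) (z : ℤ × ℤ) :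
    ∫⁻ e, Φ (fun k => H (k + z.2) e, fun k => V (k + z.1) e) ∂P
      = ∫⁻ e, Φ (fun k => H k e, fun k => V k e) ∂P := by
  have mH : ∀ a, Measurable fun (e : Ω) (k : ℤ) => H (k + a) e := fun a =>
    measurable_pi_lambda _ fun k => hHmeas _
  have mV : ∀ a, Measurable fun (e : Ω) (k : ℤ) => V (k + a) e := fun a =>
    measurable_pi_lambda _ fun k => hVmeas _
  have mH0 : Measurable fun (e : Ω) (k : ℤ) => H k e := measurable_pi_lambda _ hHmeas
  have mV0 : Measurable fun (e : Ω) (k : ℤ) => V k e := measurable_pi_lambda _ hVmeas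
  have msh : ∀ a, Measurable fun (y : ℤ → ℝ) (k : ℤ) => y (k + a) := fun a =>
    measurable_pi_lambda _ fun k => measurable_pi_apply _
  have hHV' : IndepFun (fun e k => H (k + z.2) e) (fun e k => V (k + z.1) e) P :=
    hHV.comp (msh z.2) (msh z.1)
  have h1 := (indepFun_iff_map_prod_eq_prod_map_map (mH z.2).aemeasurable
    (mV z.1).aemeasurable).1 hHV'
  have h2 := (indepFun_iff_map_prod_eq_prod_map_map mH0.aemeasurable mV0.aemeasurable).1 hHV
  rw [map_shift_eq hHmeas hHindep hHident, map_shift_eq hVmeas hVindep hVident, ← h2] at h1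
  rw [← lintegral_map hΦ ((mH z.2).prodMk (mV z.1)), h1, lintegral_map hΦ (mH0.prodMk mV0)]

/-! ### The annealed exit estimate -/

lemma card_box (N₁ N₂ : ℕ) : (box N₁ N₂).card = (2 * N₁ + 1) * (2 * N₂ + 1) := by
  rw [box, Finset.card_product, Int.card_Icc, Int.card_Icc]
  congr 1 <;> omega

lemma min_one_add_le_rpow {A B β₁ β₂ : ℝ} (hA : 0 ≤ A) (hB : 0 ≤ B) (h₁ : 0 < β₁) (h₁' : β₁ ≤ 1)
    (h₂ : 0 < β₂) (h₂' : β₂ ≤ 1) : min 1 (A + B) ≤ A ^ β₁ + B ^ β₂ := by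
  have hA' := Real.rpow_nonneg hA β₁
  have hB' := Real.rpow_nonneg hB β₂
  rcases le_or_gt 1 A with h | h
  · exact (min_le_left _ _).trans (by linarith [Real.one_le_rpow h h₁.le])
  rcases le_or_gt 1 B with h3 | h3
  · exact (min_le_left _ _).trans (by linarith [Real.one_le_rpow h3 h₂.le])
  have e : ∀ {x β : ℝ}, 0 ≤ x → x < 1 → 0 < β → β ≤ 1 → x ≤ x ^ β := by
    intro x β hx hx1 hβ hβ1
    rcases hx.eq_or_lt with rfl | hx
    · rw [Real.zero_rpow hβ.ne']
    · simpa using Real.rpow_le_rpow_of_exponent_ge hx hx1.le hβ1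
  exact (min_le_right _ _).trans (add_le_add (e hA h h₁ h₁') (e hB h3 h₂ h₂'))

/-- The annealed exit estimate: by stationarity the expectation of the squared exit transform at
the origin is at most the expectation of its average over the starting points in a box. -/
lemma lintegral_sq_exitLimit_le {Ω : Type*} [MeasurableSpace Ω] {P : Measure Ω}
    [IsProbabilityMeasure P] {H V : ℤ → Ω → ℝ}
    (hHmeas : ∀ k, Measurable (H k)) (hVmeas : ∀ k, Measurable (V k))
    (hHindep : iIndepFun H P) (hVindep : iIndepFun V P)
    (hHident : ∀ k, IdentDistrib (H k) (H 0) P P) (hVident : ∀ k, IdentDistrib (V k) (V 0) P P)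
    (hHV : IndepFun (fun e k => H k e) (fun e k => V k e) P)
    (hH : ∀ᵐ e ∂P, ∀ k, 0 < H k e) (hV : ∀ᵐ e ∂P, ∀ k, 0 < V k e)
    {β₁ β₂ : ℝ} (h₁ : 0 < β₁) (h₁' : β₁ ≤ 1) (h₂ : 0 < β₂) (h₂' : β₂ ≤ 1)
    {T : ℝ} (hT : 0 < T) {N₁ N₂ : ℕ} (hN₁ : 0 < N₁) (hN₂ : 0 < N₂) :
    ∫⁻ e, ENNReal.ofReal (exitLimit (fun k => H k e) (fun k => V k e) T⁻¹
        (box (3 * N₁) (3 * N₂)) (0, 0) ^ 2) ∂P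
      ≤ ENNReal.ofReal ((8 * T / (N₁ ^ 2 * N₂)) ^ β₁ * (4 * N₂ + 1))
          * ∫⁻ e, ENNReal.ofReal (H 0 e ^ β₁) ∂P
        + ENNReal.ofReal ((8 * T / (N₂ ^ 2 * N₁)) ^ β₂ * (4 * N₁ + 1))
          * ∫⁻ e, ENNReal.ofReal (V 0 e ^ β₂) ∂P := by
  set I₁ := Finset.Icc (-(2 * N₁ : ℕ) : ℤ) (2 * N₁ : ℕ) with hI₁
  set I₂ := Finset.Icc (-(2 * N₂ : ℕ) : ℤ) (2 * N₂ : ℕ) with hI₂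
  have n₁ : (0 : ℝ) < N₁ := by exact_mod_cast hN₁
  have n₂ : (0 : ℝ) < N₂ := by exact_mod_cast hN₂
  have hρ : 0 < T⁻¹ := inv_pos.2 hT
  have hcardI : ∀ N : ℕ, ((Finset.Icc (-(2 * N : ℕ) : ℤ) (2 * N : ℕ)).card : ℝ≥0∞)
      = ENNReal.ofReal (4 * N + 1) := by
    intro N
    have : (Finset.Icc (-(2 * N : ℕ) : ℤ) (2 * N : ℕ)).card = 4 * N + 1 := by
      rw [Int.card_Icc]; omega
    rw [this, ← ENNReal.ofReal_natCast]
    push_cast; rfl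
  set G : (ℤ → ℝ) × (ℤ → ℝ) → ℝ≥0∞ := fun w =>
    ENNReal.ofReal (exitLimit w.1 w.2 T⁻¹ (box (3 * N₁) (3 * N₂)) (0, 0) ^ 2) with hG
  have hGm : Measurable G := ((measurable_exitLimit _ _ _).pow_const 2).ennreal_ofReal
  set g : Ω → ℤ × ℤ → ℝ := fun e =>
    exitLimit (fun k => H k e) (fun k => V k e) T⁻¹ (box (2 * N₁) (2 * N₂)) with hg
  have menv : Measurable fun e : Ω => ((fun k => H k e, fun k => V k e) : (ℤ → ℝ) × (ℤ → ℝ)) :=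
    (measurable_pi_lambda _ hHmeas).prodMk (measurable_pi_lambda _ hVmeas)
  have hgm : ∀ z, Measurable fun e => ENNReal.ofReal (g e z ^ 2) := fun z =>
    (((measurable_exitLimit T⁻¹ (box (2 * N₁) (2 * N₂)) z).comp menv).pow_const 2).ennreal_ofReal
  have hz : ∀ z ∈ box N₁ N₂, ∫⁻ e, G (fun k => H k e, fun k => V k e) ∂P
      ≤ ∫⁻ e, ENNReal.ofReal (g e z ^ 2) ∂P := by
    intro z hz
    rw [← lintegral_environment_shift hHmeas hVmeas hHindep hVindep hHident hVident hHV hGm z]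
    refine lintegral_mono_ae ((hH.and hV).mono fun e he => ENNReal.ofReal_le_ofReal ?_)
    refine pow_le_pow_left₀
      (exitLimit_nonneg (fun k => he.1 (k + z.2)) (fun k => he.2 (k + z.1)) hρ _ _)
      (exitLimit_shift_le he.1 he.2 hρ fun y hy => ?_) 2
    rw [Finset.mem_coe, mem_box] at hy ⊢
    rw [mem_box] at hz
    have t1 := abs_sub y.1 z.1
    have t2 := abs_sub y.2 z.2
    rw [Prod.fst_sub, Prod.snd_sub]
    push_cast at hy ⊢
    constructor <;> linarith [hy.1, hy.2, hz.1, hz.2]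
  set n : ℝ := ((box N₁ N₂).card : ℝ) with hn
  have hn4 : 4 * (N₁ * N₂ : ℝ) ≤ n := by
    rw [hn, card_box]; push_cast; nlinarith
  have hn0 : 0 < n := lt_of_lt_of_le (by positivity) hn4
  -- the average over the starting points in the inner box
  have havg : ∫⁻ e, G (fun k => H k e, fun k => V k e) ∂P
      ≤ ∫⁻ e, ENNReal.ofReal (n⁻¹ * ∑ z ∈ box N₁ N₂, g e z ^ 2) ∂P := by
    have hsum : ENNReal.ofReal n * ∫⁻ e, G (fun k => H k e, fun k => V k e) ∂P
        ≤ ∫⁻ e, ENNReal.ofReal (∑ z ∈ box N₁ N₂, g e z ^ 2) ∂P := by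
      calc _ = ∑ _z ∈ box N₁ N₂, ∫⁻ e, G (fun k => H k e, fun k => V k e) ∂P := by
            rw [Finset.sum_const, nsmul_eq_mul, hn, ENNReal.ofReal_natCast]
        _ ≤ ∑ z ∈ box N₁ N₂, ∫⁻ e, ENNReal.ofReal (g e z ^ 2) ∂P := Finset.sum_le_sum hz
        _ = ∫⁻ e, ∑ z ∈ box N₁ N₂, ENNReal.ofReal (g e z ^ 2) ∂P :=
            (lintegral_finsetSum _ fun z _ => hgm z).symm
        _ = _ := by
            refine lintegral_congr fun e => ?_
            rw [ENNReal.ofReal_sum_of_nonneg fun z _ => sq_nonneg _]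
    have hscale : ∫⁻ e, ENNReal.ofReal (n⁻¹ * ∑ z ∈ box N₁ N₂, g e z ^ 2) ∂P
        = ENNReal.ofReal n⁻¹ * ∫⁻ e, ENNReal.ofReal (∑ z ∈ box N₁ N₂, g e z ^ 2) ∂P := by
      rw [← lintegral_const_mul' _ _ ENNReal.ofReal_ne_top]
      refine lintegral_congr fun e => ?_
      rw [ENNReal.ofReal_mul (inv_nonneg.2 hn0.le)]
    rw [hscale]
    calc _ = ENNReal.ofReal n⁻¹
          * (ENNReal.ofReal n * ∫⁻ e, G (fun k => H k e, fun k => V k e) ∂P) := by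
          rw [← mul_assoc, ← ENNReal.ofReal_mul (inv_nonneg.2 hn0.le), inv_mul_cancel₀ hn0.ne',
            ENNReal.ofReal_one, one_mul]
      _ ≤ _ := by gcongr
  refine havg.trans ?_
  -- the average is at most `1`, and at most the Caccioppoli bound; truncating the latter at `1`
  -- allows fractional moments, which are finite even when `H` and `V` have infinite mean
  have hpt : ∀ᵐ e ∂P, ENNReal.ofReal (n⁻¹ * ∑ z ∈ box N₁ N₂, g e z ^ 2)
      ≤ ENNReal.ofReal ((8 * T / (N₁ ^ 2 * N₂)) ^ β₁) * ENNReal.ofReal ((∑ y ∈ I₂, H y e) ^ β₁)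
        + ENNReal.ofReal ((8 * T / (N₂ ^ 2 * N₁)) ^ β₂)
          * ENNReal.ofReal ((∑ y ∈ I₁, V y e) ^ β₂) := by
    refine (hH.and hV).mono fun e he => ?_
    have sH : 0 ≤ ∑ y ∈ I₂, H y e := Finset.sum_nonneg fun y _ => (he.1 y).le
    have sV : 0 ≤ ∑ y ∈ I₁, V y e := Finset.sum_nonneg fun y _ => (he.2 y).le
    rw [← ENNReal.ofReal_mul (by positivity), ← ENNReal.ofReal_mul (by positivity),
      ← Real.mul_rpow (by positivity) sH, ← Real.mul_rpow (by positivity) sV,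
      ← ENNReal.ofReal_add (by positivity) (by positivity)]
    refine ENNReal.ofReal_le_ofReal (le_trans ?_
      (min_one_add_le_rpow (by positivity) (by positivity) h₁ h₁' h₂ h₂'))
    refine le_min ?_ ?_
    · rw [inv_mul_le_iff₀ hn0, mul_one, hn]
      calc ∑ z ∈ box N₁ N₂, g e z ^ 2 ≤ ∑ _z ∈ box N₁ N₂, (1 : ℝ) :=
            Finset.sum_le_sum fun z _ => pow_le_one₀ (exitLimit_nonneg he.1 he.2 hρ _ _)
              (exitLimit_le_one he.1 he.2 hρ _ _)
        _ = _ := by simp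
    · have hcac := sum_box_sq_exitLimit_le he.1 he.2 hρ hN₁ hN₂
      rw [inv_mul_le_iff₀ hT] at hcac
      rw [inv_mul_le_iff₀ hn0]
      refine hcac.trans ?_
      calc T * (16 * (2 / N₁ * ∑ y ∈ I₂, H y e + 2 / N₂ * ∑ y ∈ I₁, V y e))
          = 4 * (N₁ * N₂) * (8 * T / (N₁ ^ 2 * N₂) * ∑ y ∈ I₂, H y e
            + 8 * T / (N₂ ^ 2 * N₁) * ∑ y ∈ I₁, V y e) := by field_simp; ring
        _ ≤ _ := by gcongr
  refine (lintegral_mono_ae hpt).trans ?_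
  have mHs : Measurable fun e => ENNReal.ofReal ((∑ y ∈ I₂, H y e) ^ β₁) :=
    ((Finset.measurable_fun_sum _ fun y _ => hHmeas y).pow_const β₁).ennreal_ofReal
  rw [lintegral_add_left (mHs.const_mul _), lintegral_const_mul' _ _ ENNReal.ofReal_ne_top,
    lintegral_const_mul' _ _ ENNReal.ofReal_ne_top, ENNReal.ofReal_mul (by positivity),
    ENNReal.ofReal_mul (by positivity), ← hcardI, ← hcardI, mul_assoc, mul_assoc]
  gcongr
  · exact lintegral_sum_rpow_le hHmeas hHident hH h₁ h₁' I₂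
  · exact lintegral_sum_rpow_le hVmeas hVident hV h₂ h₂' I₁

/-! ### Choice of the scales and convergence -/


lemma epsilonExponent_nonneg (α : ℝ) : 0 ≤ epsilonExponent α := le_max_right _ _

/-- Room below `a₁` and `a₂`: the fixed point of `b₁ = 1 + ε₁ b₂`, `b₂ = 1 + ε₂ b₁` is
`bᵢ = (1 + εᵢ) / (1 - ε₁ ε₂)`, and multiplying it by a factor slightly above `1` gives strict
inequalities. -/
lemma exists_scaling_exponents {ε₁ ε₂ a₁ a₂ : ℝ} (h₁ : 0 ≤ ε₁) (h₂ : 0 ≤ ε₂) (hε : ε₁ * ε₂ < 1)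
    (ha₁ : (1 + ε₁) / (1 - ε₁ * ε₂) < a₁) (ha₂ : (1 + ε₂) / (1 - ε₁ * ε₂) < a₂) :
    ∃ b₁ b₂ : ℝ, 0 < b₁ ∧ 0 < b₂ ∧ b₁ < a₁ ∧ b₂ < a₂ ∧ 1 + ε₁ * b₂ < b₁ ∧ 1 + ε₂ * b₁ < b₂ := by
  have hD : 0 < 1 - ε₁ * ε₂ := by linarith
  have l1 : 1 / (1 - ε₁ * ε₂) < a₁ / (1 + ε₁) := by
    rw [lt_div_iff₀ (by positivity), one_div_mul_eq_div]; exact ha₁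
  have l2 : 1 / (1 - ε₁ * ε₂) < a₂ / (1 + ε₂) := by
    rw [lt_div_iff₀ (by positivity), one_div_mul_eq_div]; exact ha₂
  obtain ⟨z, hz1, hz2⟩ := exists_between (lt_min l1 l2)
  have hz : 0 < z := lt_trans (by positivity) hz1
  rw [div_lt_iff₀ hD] at hz1
  have hz3 := (lt_div_iff₀ (by positivity)).1 (hz2.trans_le (min_le_left _ _))
  have hz4 := (lt_div_iff₀ (by positivity)).1 (hz2.trans_le (min_le_right _ _))
  exact ⟨z * (1 + ε₁), z * (1 + ε₂), by positivity, by positivity, hz3, hz4,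
    by linarith, by linarith⟩

/-- A moment exponent `β < min α 1` close enough to `min α 1` for the annealed exit estimate to
decay. -/
lemma exists_moment_exponent {α b b' : ℝ} (hα : 0 < α) (hb' : 0 < b')
    (h : 1 + epsilonExponent α * b' < b) :
    ∃ β : ℝ, 0 < β ∧ β ≤ 1 ∧ β < α ∧ 0 < β * (b - 1) - b' * (1 - β) / 2 := by
  have hlt : epsilonExponent α < (b - 1) / b' := by rw [lt_div_iff₀ hb']; linarith
  obtain ⟨q, hq1, hq2⟩ := exists_between hlt
  have hq0 : 0 < q := (epsilonExponent_nonneg α).trans_lt hq1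
  have hα' : 1 / α < 1 + 2 * q := by
    have : (1 / α - 1) / 2 ≤ epsilonExponent α := le_max_left _ _
    linarith
  rw [lt_div_iff₀ hb'] at hq2
  refine ⟨1 / (1 + 2 * q), by positivity, ?_, ?_, ?_⟩
  · rw [div_le_one (by positivity)]; linarith
  · exact (one_div_lt hα (by positivity)).1 hα'
  · have e : 1 / (1 + 2 * q) * (b - 1) - b' * (1 - 1 / (1 + 2 * q)) / 2
        = (b - 1 - q * b') / (1 + 2 * q) := by field_simp; ring
    rw [e]
    exact div_pos (by linarith) (by positivity)

/-- The scale `⌈T^{b / 2}⌉` at time `T = 2 ^ k`. -/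
noncomputable def scale (b : ℝ) (k : ℕ) : ℕ := ⌈(2 : ℝ) ^ (b * k / 2)⌉₊

lemma scale_pos (b : ℝ) (k : ℕ) : 0 < scale b k := Nat.ceil_pos.2 (by positivity)

lemma le_scale (b : ℝ) (k : ℕ) : (2 : ℝ) ^ (b * k / 2) ≤ scale b k := Nat.le_ceil _

lemma scale_le {b : ℝ} (hb : 0 < b) (k : ℕ) : (scale b k : ℝ) ≤ 2 * (2 : ℝ) ^ (b * k / 2) := by
  have h1 : 1 ≤ (2 : ℝ) ^ (b * k / 2) := Real.one_le_rpow one_le_two (by positivity)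
  have h2 := Nat.ceil_lt_add_one (show 0 ≤ (2 : ℝ) ^ (b * k / 2) by positivity)
  unfold scale
  linarith

/-- At time `T = 2 ^ k` and on the scales `T^{b / 2}`, `T^{b' / 2}`, the coefficients in
`lintegral_sq_exitLimit_le` decay geometrically in `k`. -/
lemma annealed_term_le {b b' β : ℝ} (hb' : 0 < b') (hβ₀ : 0 < β) (hβ₁ : β ≤ 1) (k : ℕ) :
    (8 * 2 ^ k / ((scale b k : ℝ) ^ 2 * scale b' k)) ^ β * (4 * scale b' k + 1)
      ≤ 80 * ((2 : ℝ) ^ (-(β * (b - 1) - b' * (1 - β) / 2))) ^ k := by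
  have hX := le_scale b k
  have hY := scale_le hb' k
  have hN : (1 : ℝ) ≤ scale b' k := by exact_mod_cast scale_pos b' k
  set N : ℝ := ((scale b' k : ℕ) : ℝ) with hNdef
  set X : ℝ := (2 : ℝ) ^ (b * k / 2) with hXdef
  set Y : ℝ := (2 : ℝ) ^ (b' * k / 2) with hYdef
  have hX0 : 0 < X := by positivity
  have hY0 : 0 < Y := by positivity
  have hN0 : 0 < N := by linarith
  have s1 : (8 * 2 ^ k / ((scale b k : ℝ) ^ 2 * N)) ^ β ≤ 8 * (2 ^ k / X ^ 2) ^ β * N ^ (-β) := by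
    have e1 : 8 * 2 ^ k / ((scale b k : ℝ) ^ 2 * N) ≤ 8 * (2 ^ k / X ^ 2) * N⁻¹ := by
      calc _ ≤ 8 * 2 ^ k / (X ^ 2 * N) := by gcongr
        _ = _ := by field_simp
    refine (Real.rpow_le_rpow (by positivity) e1 hβ₀.le).trans ?_
    rw [Real.mul_rpow (by positivity) (by positivity),
      Real.mul_rpow (by positivity) (by positivity),
      Real.inv_rpow hN0.le, ← Real.rpow_neg hN0.le]
    gcongr
    calc (8 : ℝ) ^ β ≤ 8 ^ (1 : ℝ) := Real.rpow_le_rpow_of_exponent_le (by norm_num) hβ₁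
      _ = 8 := Real.rpow_one 8
  have s2 : N ^ (-β) * (4 * N + 1) ≤ 10 * Y ^ (1 - β) := by
    calc N ^ (-β) * (4 * N + 1) ≤ N ^ (-β) * (5 * N) := by gcongr; linarith
      _ = 5 * N ^ (1 - β) := by
        rw [show (1 : ℝ) - β = -β + 1 by ring, Real.rpow_add hN0, Real.rpow_one]; ring
      _ ≤ 5 * (2 * Y) ^ (1 - β) := by gcongr
      _ = 5 * (2 ^ (1 - β) * Y ^ (1 - β)) := by rw [Real.mul_rpow (by norm_num) hY0.le]
      _ ≤ 5 * (2 * Y ^ (1 - β)) := by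
        gcongr
        calc (2 : ℝ) ^ (1 - β) ≤ 2 ^ (1 : ℝ) :=
              Real.rpow_le_rpow_of_exponent_le one_le_two (by linarith)
          _ = 2 := Real.rpow_one 2
      _ = _ := by ring
  calc _ ≤ 8 * (2 ^ k / X ^ 2) ^ β * N ^ (-β) * (4 * N + 1) := by gcongr
    _ = 8 * (2 ^ k / X ^ 2) ^ β * (N ^ (-β) * (4 * N + 1)) := by ring
    _ ≤ 8 * (2 ^ k / X ^ 2) ^ β * (10 * Y ^ (1 - β)) := by gcongr
    _ = 80 * ((2 ^ k / X ^ 2) ^ β * Y ^ (1 - β)) := by ring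
    _ = _ := by
      congr 1
      rw [hXdef, hYdef, ← Real.rpow_natCast 2 k, ← Real.rpow_natCast _ 2, ← Real.rpow_natCast _ k,
        ← Real.rpow_mul (by norm_num), ← Real.rpow_mul (by norm_num),
        ← Real.rpow_mul (by norm_num), ← Real.rpow_sub (by norm_num),
        ← Real.rpow_mul (by norm_num), ← Real.rpow_add (by norm_num)]
      congr 1
      push_cast
      ring

lemma tsum_annealed_term_lt_top {b b' β : ℝ} (hb' : 0 < b') (hβ₀ : 0 < β) (hβ₁ : β ≤ 1)
    (hθ : 0 < β * (b - 1) - b' * (1 - β) / 2) :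
    ∑' k : ℕ, ENNReal.ofReal
      ((8 * 2 ^ k / ((scale b k : ℝ) ^ 2 * scale b' k)) ^ β * (4 * scale b' k + 1)) < ∞ := by
  set q : ℝ := (2 : ℝ) ^ (-(β * (b - 1) - b' * (1 - β) / 2)) with hq
  have hq0 : 0 ≤ q := by positivity
  have hq1 : q < 1 := Real.rpow_lt_one_of_one_lt_of_neg one_lt_two (by linarith)
  have hs : Summable fun k : ℕ => 80 * q ^ k := (summable_geometric_of_lt_one hq0 hq1).mul_left 80
  refine lt_of_le_of_lt (ENNReal.tsum_le_tsum fun k =>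
    ENNReal.ofReal_le_ofReal (annealed_term_le hb' hβ₀ hβ₁ k)) ?_
  rw [← ENNReal.ofReal_tsum_of_nonneg (fun k => by positivity) hs]
  exact ENNReal.ofReal_lt_top

lemma quenchedLaw_exit_le_exitLimit {h v : ℤ → ℝ} (hh : ∀ k, 0 < h k) (hv : ∀ k, 0 < v k) {ρ : ℝ}
    (hρ : 0 < ρ) (Q : Set (ℤ × ℤ)) {t : ℝ} (ht : 0 ≤ t) :
    quenchedLaw (lineEnvironment h v)
        {p | ∃ s ≤ t, ∀ x ∈ Q, walk (lineEnvironment h v) p s ≠ some x}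
      ≤ ENNReal.ofReal (Real.exp (ρ * t) * exitLimit h v ρ Q (0, 0)) :=
  ge_of_tendsto (ENNReal.tendsto_ofReal
    ((tendsto_exitTransform hh hv hρ Q (0, 0)).const_mul (Real.exp (ρ * t))))
    (Eventually.of_forall fun n => quenchedLaw_exit_le hh hv hρ Q n ht)

/-- Passage from the times `2 ^ k` to all times: for `2 ^ k ≤ T < 2 ^ (k + 1)`, a displacement of
order `T^{a / 2}` before time `T t` forces an exit from the box `B k`, of size `2^{b k / 2}`, before
time `2 ^ k * 2 t`. -/
lemma tendstoZeroInProbability_of_exitLimit {h v : ℤ → ℝ} (hh : ∀ k, 0 < h k) (hv : ∀ k, 0 < v k)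
    {B : ℕ → Finset (ℤ × ℤ)}
    (hB : Tendsto (fun k => exitLimit h v ((2 : ℝ) ^ k)⁻¹ (B k) (0, 0)) atTop (𝓝 0))
    {F : Option (ℤ × ℤ) → ℝ≥0∞} {a b : ℝ} (ha : 0 < a) (hba : b < a)
    (hF : ∀ k, ∀ x ∈ B k, F (some x) ≤ ENNReal.ofReal (6 * 2 ^ (b * k / 2))) {t : ℝ} (ht : 0 < t) :
    TendstoZeroInProbability (quenchedLaw (lineEnvironment h v)) fun T p =>
      ⨆ s ∈ Set.Icc (0 : ℝ) t,
        ENNReal.ofReal (T ^ (-a / 2)) * F (walk (lineEnvironment h v) p (T * s)) := by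
  intro δ hδ
  have hlog : Tendsto (fun T : ℝ => Nat.log 2 ⌊T⌋₊) atTop atTop := by
    refine tendsto_atTop.2 fun n => ?_
    filter_upwards [eventually_ge_atTop ((2 : ℝ) ^ n)] with T hT
    refine Nat.le_log_of_pow_le one_lt_two (Nat.le_floor ?_)
    push_cast
    exact hT
  have hU : Tendsto (fun T : ℝ => ENNReal.ofReal (Real.exp (2 * t) * exitLimit h v
      ((2 : ℝ) ^ Nat.log 2 ⌊T⌋₊)⁻¹ (B (Nat.log 2 ⌊T⌋₊)) (0, 0))) atTop (𝓝 0) := by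
    have := ENNReal.tendsto_ofReal ((hB.comp hlog).const_mul (Real.exp (2 * t)))
    simpa using this
  have hsmall : ∀ᶠ k : ℕ in atTop, 6 * ((2 : ℝ) ^ ((b - a) / 2)) ^ k < δ := by
    have h1 : Tendsto (fun k : ℕ => 6 * ((2 : ℝ) ^ ((b - a) / 2)) ^ k) atTop (𝓝 (6 * 0)) :=
      (tendsto_pow_atTop_nhds_zero_of_lt_one (by positivity)
        (Real.rpow_lt_one_of_one_lt_of_neg one_lt_two (by linarith))).const_mul 6
    rw [mul_zero] at h1
    exact h1.eventually (gt_mem_nhds hδ)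
  refine tendsto_of_tendsto_of_tendsto_of_le_of_le' tendsto_const_nhds hU
    (Eventually.of_forall fun _ => zero_le) ?_
  filter_upwards [hlog.eventually hsmall, eventually_ge_atTop 1] with T hk hT
  set k := Nat.log 2 ⌊T⌋₊ with hkdef
  have hfl : ⌊T⌋₊ ≠ 0 := (Nat.floor_pos.2 hT).ne'
  have hT0 : 0 < T := by linarith
  have hkT : (2 : ℝ) ^ k ≤ T := by
    have h1 : ((2 ^ k : ℕ) : ℝ) ≤ ⌊T⌋₊ := by exact_mod_cast Nat.pow_log_le_self 2 hfl
    push_cast at h1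
    exact h1.trans (Nat.floor_le hT0.le)
  have hTk : T ≤ 2 * (2 : ℝ) ^ k := by
    have h1 : ((⌊T⌋₊ + 1 : ℕ) : ℝ) ≤ ((2 ^ (k + 1) : ℕ) : ℝ) := by
      exact_mod_cast Nat.lt_pow_succ_log_self one_lt_two ⌊T⌋₊
    push_cast at h1
    have h2 := (Nat.lt_floor_add_one T).le
    rw [pow_succ] at h1
    linarith
  have hρ : 0 < ((2 : ℝ) ^ k)⁻¹ := by positivity
  have hexit := quenchedLaw_exit_le_exitLimit hh hv hρ (B k : Set (ℤ × ℤ))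
    (t := 2 * t * 2 ^ k) (by positivity)
  rw [show ((2 : ℝ) ^ k)⁻¹ * (2 * t * 2 ^ k) = 2 * t by field_simp] at hexit
  refine (measure_mono ?_).trans hexit
  intro p hp
  by_contra hcon
  simp only [Set.mem_ofPred_eq, not_exists, not_and, not_forall, not_not] at hcon hp
  refine absurd hp (not_le.2 (lt_of_le_of_lt ?_ ((ENNReal.ofReal_lt_ofReal_iff hδ).2 hk)))
  refine iSup₂_le fun s hs => ?_
  obtain ⟨x, hx, hxs⟩ := hcon (T * s) (by
    calc T * s ≤ 2 * 2 ^ k * t := mul_le_mul hTk hs.2 hs.1 (by positivity)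
      _ = _ := by ring)
  rw [hxs]
  calc ENNReal.ofReal (T ^ (-a / 2)) * F (some x)
      ≤ ENNReal.ofReal (((2 : ℝ) ^ k) ^ (-a / 2)) * ENNReal.ofReal (6 * 2 ^ (b * k / 2)) := by
        refine mul_le_mul' (ENNReal.ofReal_le_ofReal ?_) (hF k x hx)
        exact Real.rpow_le_rpow_of_nonpos (by positivity) hkT (by linarith)
    _ = ENNReal.ofReal (6 * ((2 : ℝ) ^ ((b - a) / 2)) ^ k) := by
        rw [← ENNReal.ofReal_mul (by positivity)]
        congr 1
        rw [← Real.rpow_natCast 2 k, ← Real.rpow_natCast _ k, ← Real.rpow_mul (by norm_num),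
          ← Real.rpow_mul (by norm_num), mul_left_comm, ← Real.rpow_add (by norm_num)]
        congr 2
        ring

end LineModel

theorem proposition3p2 {Ω : Type*} [MeasurableSpace Ω] (P : Measure Ω) [IsProbabilityMeasure P]
    (H V : ℤ → Ω → ℝ)
    (hHmeas : ∀ k, Measurable (H k)) (hVmeas : ∀ k, Measurable (V k))
    (hHindep : iIndepFun H P) (hVindep : iIndepFun V P)
    (hHident : ∀ k, IdentDistrib (H k) (H 0) P P) (hVident : ∀ k, IdentDistrib (V k) (V 0) P P)
    (hHV : IndepFun (fun e k => H k e) (fun e k => V k e) P)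
    (hlower : ∃ c : ℝ, 0 < c ∧ ∀ k, ∀ᵐ e ∂P, c ≤ H k e ∧ c ≤ V k e)
    (α₁ α₂ : ℝ) (hα₁ : 0 < α₁) (hα₂ : 0 < α₂)
    (hHtail : LineModel.HasTailExponent P (H 0) α₁)
    (hVtail : LineModel.HasTailExponent P (V 0) α₂)
    (ε₁ ε₂ : ℝ) (hε₁ : ε₁ = LineModel.epsilonExponent α₁)
    (hε₂ : ε₂ = LineModel.epsilonExponent α₂)
    (hε : ε₁ * ε₂ < 1)
    (a₁ a₂ : ℝ) (ha₁ : (1 + ε₁) / (1 - ε₁ * ε₂) < a₁) (ha₂ : (1 + ε₂) / (1 - ε₁ * ε₂) < a₂) :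
    ∀ᵐ e ∂P, ∀ t : ℝ, 0 < t →
      LineModel.TendstoZeroInProbability
        (LineModel.quenchedLaw (LineModel.lineEnvironment (fun k => H k e) (fun k => V k e)))
        (fun T => LineModel.supFst
          (LineModel.lineEnvironment (fun k => H k e) (fun k => V k e)) a₁ t T) ∧
      LineModel.TendstoZeroInProbability
        (LineModel.quenchedLaw (LineModel.lineEnvironment (fun k => H k e) (fun k => V k e)))
        (fun T => LineModel.supSnd
          (LineModel.lineEnvironment (fun k => H k e) (fun k => V k e)) a₂ t T) := by
  open LineModel in
  obtain ⟨c, hc, hlow⟩ := hlower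
  have hlow' := ae_all_iff.2 hlow
  have hH : ∀ᵐ e ∂P, ∀ k, 0 < H k e := hlow'.mono fun e he k => hc.trans_le (he k).1
  have hV : ∀ᵐ e ∂P, ∀ k, 0 < V k e := hlow'.mono fun e he k => hc.trans_le (he k).2
  have e₁ : 0 ≤ ε₁ := hε₁ ▸ epsilonExponent_nonneg α₁
  have e₂ : 0 ≤ ε₂ := hε₂ ▸ epsilonExponent_nonneg α₂
  obtain ⟨b₁, b₂, hb₁, hb₂, hba₁, hba₂, h₁₂, h₂₁⟩ :=
    exists_scaling_exponents e₁ e₂ hε ha₁ ha₂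
  rw [hε₁] at h₁₂
  rw [hε₂] at h₂₁
  obtain ⟨β₁, hβ₁, hβ₁', hβα₁, hθ₁⟩ := exists_moment_exponent hα₁ hb₂ h₁₂
  obtain ⟨β₂, hβ₂, hβ₂', hβα₂, hθ₂⟩ := exists_moment_exponent hα₂ hb₁ h₂₁
  have mH := hHtail.lintegral_rpow_lt_top (hHmeas 0) (hH.mono fun e he => (he 0).le) hβ₁ hβα₁
  have mV := hVtail.lintegral_rpow_lt_top (hVmeas 0) (hV.mono fun e he => (he 0).le) hβ₂ hβα₂
  set B : ℕ → Finset (ℤ × ℤ) := fun k => box (3 * scale b₁ k) (3 * scale b₂ k) with hB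
  set g : ℕ → Ω → ℝ := fun k e =>
    exitLimit (fun j => H j e) (fun j => V j e) ((2 : ℝ) ^ k)⁻¹ (B k) (0, 0) with hg
  have menv : Measurable fun e : Ω => ((fun k => H k e, fun k => V k e) : (ℤ → ℝ) × (ℤ → ℝ)) :=
    (measurable_pi_lambda _ hHmeas).prodMk (measurable_pi_lambda _ hVmeas)
  have hgm : ∀ k, Measurable fun e => ENNReal.ofReal (g k e ^ 2) := fun k =>
    (((measurable_exitLimit ((2 : ℝ) ^ k)⁻¹ (B k) (0, 0)).comp menv).pow_const 2).ennreal_ofReal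
  -- Borel–Cantelli: the squared exit transforms are almost surely summable along `T = 2 ^ k`
  have hsum : ∫⁻ e, ∑' k, ENNReal.ofReal (g k e ^ 2) ∂P ≠ ∞ := by
    rw [lintegral_tsum fun k => (hgm k).aemeasurable]
    refine ne_of_lt (lt_of_le_of_lt (ENNReal.tsum_le_tsum fun k =>
      lintegral_sq_exitLimit_le hHmeas hVmeas hHindep hVindep hHident hVident hHV hH hV
        hβ₁ hβ₁' hβ₂ hβ₂' (T := 2 ^ k) (by positivity) (scale_pos b₁ k) (scale_pos b₂ k)) ?_)
    rw [ENNReal.tsum_add, ENNReal.tsum_mul_right, ENNReal.tsum_mul_right]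
    exact ENNReal.add_lt_top.2
      ⟨ENNReal.mul_lt_top (tsum_annealed_term_lt_top hb₂ hβ₁ hβ₁' hθ₁) mH,
        ENNReal.mul_lt_top (tsum_annealed_term_lt_top hb₁ hβ₂ hβ₂' hθ₂) mV⟩
  have hae := ae_lt_top (Measurable.tsum hgm) hsum
  filter_upwards [hH, hV, hae] with e hHe hVe hge t ht
  have hlim : Tendsto (fun k => g k e) atTop (𝓝 0) := by
    have h1 := ENNReal.tendsto_atTop_zero_of_tsum_ne_top hge.ne
    have h2 := ((ENNReal.tendsto_toReal ENNReal.zero_ne_top).comp h1).sqrt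
    simpa [Function.comp_def, ENNReal.toReal_ofReal (sq_nonneg _), g,
      Real.sqrt_sq (exitLimit_nonneg hHe hVe (inv_pos.2 (pow_pos two_pos _)) _ _)] using h2
  have hscale : ∀ {b : ℝ}, 0 < b → ∀ k, ∀ n : ℤ, |n| ≤ (3 * scale b k : ℕ) →
      (n.natAbs : ℝ≥0∞) ≤ ENNReal.ofReal (6 * 2 ^ (b * k / 2)) := by
    intro b hb k n hn
    have h1 : n.natAbs ≤ 3 * scale b k := by rwa [Int.abs_eq_natAbs, Nat.cast_le] at hn
    have h2 : (n.natAbs : ℝ) ≤ 3 * scale b k := by exact_mod_cast h1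
    rw [← ENNReal.ofReal_natCast]
    exact ENNReal.ofReal_le_ofReal (by linarith [scale_le hb k])
  exact ⟨tendstoZeroInProbability_of_exitLimit hHe hVe hlim (F := absFst) (hb₁.trans hba₁) hba₁
      (fun k x hx => hscale hb₁ k x.1 (mem_box.1 hx).1) ht,
    tendstoZeroInProbability_of_exitLimit hHe hVe hlim (F := absSnd) (hb₂.trans hba₂) hba₂
      (fun k x hx => hscale hb₂ k x.2 (mem_box.1 hx).2) ht⟩
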